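/- Let $(P,\omega)$ be a smooth (Hausdorff) symplectic manifold of dimension $2m$. Let $\flat(X)=i(X)\omega=\omega(X,\cdot)$, let $\sharp=\flat^{-1}:T^*P\to TP$, and let $\flat_k,\sharp_k$ be the $k$-th exterior powers of $\flat$ and $\sharp$. Write $\langle\alpha\wedge\beta,\Pi\rangle=\omega(\sharp\alpha,\sharp\beta)$ for the Poisson bivector and $\{f,g\}=\langle df\wedge dg,\Pi\rangle=df(\sharp dg)$ for the Poisson bracket. For $k\ge 1$ let $\delta_\Pi^k:\Omega^k(P)\to\Omega^{k-1}(P)$ be the canonical (Poisson homology) boundary operator, i.e. the linear extension to all $k$-forms, through local representations $\eta=\sum_s\varphi_0^s\,d\varphi_1^s\wedge\cdots\wedge d\varphi_k^s$ with smooth functions $\varphi_i^s$, of $$\delta_\Pi^k(\varphi_0\,d\varphi_1\wedge\cdots\wedge d\varphi_k)=\sum_{i}(-1)^{i+1}\{\varphi_0,\varphi_i\}\,d\varphi_1\wedge\cdots\widehat{d\varphi_i}\cdots\wedge d\varphi_k+\sum_{i<j}(-1)^{i+j}\varphi_0\,d\{\varphi_i,\varphi_j\}\wedge d\varphi_1\wedge\cdots\widehat{d\varphi_i}\cdots\widehat{d\varphi_j}\cdots\wedge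 d\varphi_k .$$ Let $D$ be a contravariant derivative on $P$, i.e. an $\mathbb R$-linear map $D:\Omega^1(P)\to\Gamma^\infty(TP\otimes T^*P)$, written $D_\eta\alpha=\langle\eta,D\alpha\rangle$, with $D_\eta(f\alpha)=fD_\eta\alpha+((\sharp\eta)f)\alpha$. Extend it to $k$-vector fields by $$\langle\alpha_1\wedge\cdots\wedge\alpha_k,D_\eta A\rangle=(\sharp\eta)\langle\alpha_1\wedge\cdots\wedge\alpha_k,A\rangle-\sum_i\langle\alpha_1\wedge\cdots\wedge D_\eta\alpha_i\wedge\cdots\wedge\alpha_k,A\rangle .$$ Assume that $D$ is a Poisson connection, i.e. $(\sharp\alpha)\langle\beta\wedge\gamma,\Pi\rangle=\langle D_\alpha\beta\wedge\gamma,\Pi\rangle+\langle\beta\wedge D_\alpha\gamma,\Pi\rangle$ for all $1$-forms $\alpha,\beta,\gamma$, and that its torsion vanishes, i.e. $D_\alpha\beta-D_\beta\alpha=\mathcal L_{\sharp\alpha}\beta-\mathcal L_{\sharp\beta}\alpha+d\langle\alpha\wedge\beta,\Pi\rangle$ for all $1$-forms $\alpha,\beta$. Let $\nabla$ be the symplectic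 connection induced by $D$; on $k$-forms it is $\nabla_X\eta=(\flat_k\circ D_{\flat(X)}\circ\sharp_k)(\eta)$. Then, for every $k\ge1$, the operator $\delta_\Pi^k$ is well defined, so that it satisfies the formula above for all smooth functions $\varphi_0,\dots,\varphi_k$ on $P$; and for every open set $U\subset P$, every smooth local frame $e_1,\dots,e_{2m}$ of $TP$ on $U$ with dual coframe $\theta^1,\dots,\theta^{2m}$, and every $\eta\in\Omega^k(P)$, $$\delta_\Pi^k\eta\,\big|_U=\sum_{i=1}^{2m} i(e_i)\,\nabla_{\sharp\theta^i}\eta .$$ -/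

import Mathlib

open scoped Manifold ContDiff Topology

noncomputable section

namespace Symp

/-- The exterior product `l₀ ∧ ⋯ ∧ l_{k-1}` of linear forms, in the determinant convention
`(l₀ ∧ ⋯ ∧ l_{k-1})(v₀, …, v_{k-1}) = det (lⱼ (vᵢ))`. -/
def wedge {V : Type*} [AddCommGroup V] [Module ℝ V] {k : ℕ} (l : Fin k → Module.Dual ℝ V) :
    V [⋀^Fin k]→ₗ[ℝ] ℝ :=
  Matrix.detRowAlternating.compLinearMap (LinearMap.pi l)

section Fields

variable (E : Type*) [NormedAddCommGroup E] [NormedSpace ℝ E]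
  (M : Type*) [TopologicalSpace M] [ChartedSpace E M]

/-- The tangent space at a point of a manifold modelled on `E`. -/
abbrev T {M : Type*} [TopologicalSpace M] [ChartedSpace E M] (x : M) : Type _ :=
  TangentSpace 𝓘(ℝ, E) x

/-- The cotangent space at a point. -/
abbrev CoT {M : Type*} [TopologicalSpace M] [ChartedSpace E M] (x : M) : Type _ :=
  Module.Dual ℝ (TangentSpace 𝓘(ℝ, E) x)

variable {E M} in
/-- The differential of a real function at a point, as a covector. -/
def dAt (f : M → ℝ) (x : M) : CoT E x :=
  (mvfderiv 𝓘(ℝ, E) f x : TangentSpace 𝓘(ℝ, E) x →L[ℝ] ℝ)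

variable [IsManifold 𝓘(ℝ, E) ∞ M]

variable {E M} in
/-- Smooth vector fields. -/
def IsSmoothVF (X : ∀ x : M, T E x) : Prop :=
  ContMDiff 𝓘(ℝ, E) 𝓘(ℝ, E).tangent ∞ (fun x => (⟨x, X x⟩ : TangentBundle 𝓘(ℝ, E) M))

/-- The space `Ω¹(M)` of smooth `1`-forms. -/
def OneForm : Submodule ℝ (∀ x : M, CoT E x) where
  carrier := {α | ∀ X : ∀ x : M, T E x, IsSmoothVF X →
    ContMDiff 𝓘(ℝ, E) 𝓘(ℝ, ℝ) ∞ (fun x => α x (X x))}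
  add_mem' ha hb X hX := (ha X hX).add (hb X hX)
  zero_mem' _ _ := contMDiff_const
  smul_mem' _ _ ha X hX := contMDiff_const.mul (ha X hX)

/-- The space `Ωᵏ(M)` of smooth differential `k`-forms. -/
def Form (k : ℕ) : Submodule ℝ (∀ x : M, T E x [⋀^Fin k]→ₗ[ℝ] ℝ) where
  carrier := {η | ∀ X : Fin k → ∀ x : M, T E x, (∀ i, IsSmoothVF (X i)) →
    ContMDiff 𝓘(ℝ, E) 𝓘(ℝ, ℝ) ∞ (fun x => η x (fun i => X i x))}
  add_mem' ha hb X hX := (ha X hX).add (hb X hX)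
  zero_mem' _ _ := contMDiff_const
  smul_mem' _ _ ha X hX := contMDiff_const.mul (ha X hX)

variable {E M}

/-- The product of a smooth function and a smooth `1`-form. -/
def OneForm.fsmul (f : C^∞⟮𝓘(ℝ, E), M; ℝ⟯) (α : OneForm E M) : OneForm E M :=
  ⟨fun x => f x • α.1 x, fun X hX => f.contMDiff.mul (α.2 X hX)⟩

/-- The Lie derivative of a `1`-form `β` along `X`, evaluated on `Y`:
`(L_X β)(Y) = X (β(Y)) - β([X, Y])`. -/
def lieDeriv (X : ∀ x : M, T E x) (β : ∀ x : M, CoT E x) (Y : ∀ x : M, T E x) (x : M) : ℝ :=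
  dAt (E := E) (fun z => β z (Y z)) x (X x) - β x (VectorField.mlieBracket 𝓘(ℝ, E) X Y x)

variable (E M) in
/-- A symplectic form on `M`: a closed nondegenerate smooth `2`-form. Closedness is expressed by
the invariant formula for the exterior derivative. -/
structure SymplecticForm where
  form : Form E M 2
  nondegenerate : ∀ (x : M) (v : T E x), (∀ w : T E x, form.1 x ![v, w] = 0) → v = 0
  closed : ∀ X Y Z : ∀ x : M, T E x, IsSmoothVF X → IsSmoothVF Y → IsSmoothVF Z → ∀ x : M,
    dAt (E := E) (fun z => form.1 z ![Y z, Z z]) x (X x)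
      - dAt (E := E) (fun z => form.1 z ![X z, Z z]) x (Y x)
      + dAt (E := E) (fun z => form.1 z ![X z, Y z]) x (Z x)
      - form.1 x ![VectorField.mlieBracket 𝓘(ℝ, E) X Y x, Z x]
      + form.1 x ![VectorField.mlieBracket 𝓘(ℝ, E) X Z x, Y x]
      - form.1 x ![VectorField.mlieBracket 𝓘(ℝ, E) Y Z x, X x] = 0

namespace SymplecticForm

variable (Ω : SymplecticForm E M)

/-- `♭ : T_xM → T_x^*M`, `♭(v) = i(v) Ω = Ω(v, ·)`. -/
def flat (x : M) : T E x →ₗ[ℝ] CoT E x :=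
  LinearMap.mk₂ ℝ (fun v w => Ω.form.1 x ![v, w])
    (fun v v' w => (Ω.form.1 x).map_vecCons_add ![w] v v')
    (fun c v w => (Ω.form.1 x).map_vecCons_smul ![w] c v)
    (fun v w w' => by
      have e : ∀ u : T E x, Function.update ![v, w] 1 u = ![v, u] := fun u => by
        funext i; fin_cases i <;> rfl
      have h := (Ω.form.1 x).map_update_add ![v, w] 1 w w'
      rwa [e, e, e] at h)
    (fun c v w => by
      have e : ∀ u : T E x, Function.update ![v, w] 1 u = ![v, u] := fun u => by
        funext i; fin_cases i <;> rfl
      have h := (Ω.form.1 x).map_update_smul ![v, w] 1 c w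
      rwa [e, e] at h)

@[simp]
theorem flat_apply (x : M) (v w : T E x) : Ω.flat x v w = Ω.form.1 x ![v, w] := rfl

theorem flat_swap (x : M) (v w : T E x) : Ω.flat x v w = - Ω.flat x w v := by
  have h := (Ω.form.1 x).map_swap ![w, v] (i := 0) (j := 1) (by decide)
  have e : (![w, v] ∘ Equiv.swap (0 : Fin 2) 1) = ![v, w] := by
    funext i; fin_cases i <;> simp
  rw [e] at h
  simpa using h

theorem flat_injective (x : M) : Function.Injective (Ω.flat x) := by
  rw [← LinearMap.ker_eq_bot, LinearMap.ker_eq_bot']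
  intro v hv
  exact Ω.nondegenerate x v fun w => by rw [← flat_apply, hv]; rfl

instance [FiniteDimensional ℝ E] (x : M) : FiniteDimensional ℝ (T E x) := inferInstanceAs (FiniteDimensional ℝ E)

variable [FiniteDimensional ℝ E]

/-- `♭` as a linear isomorphism. -/
def flatEquiv (x : M) : T E x ≃ₗ[ℝ] CoT E x :=
  LinearEquiv.ofInjectiveOfFinrankEq (Ω.flat x) (Ω.flat_injective x)
    (Subspace.dual_finrank_eq (K := ℝ) (V := T E x)).symm

/-- `♯ : T_x^*M → T_xM`, the inverse of `♭`. -/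
def sharp (x : M) : CoT E x →ₗ[ℝ] T E x := (Ω.flatEquiv x).symm

/-- The Poisson bivector of `Ω`, as a bilinear function of covectors:
`⟨α ∧ β, Π⟩ = Ω(♯α, ♯β)`. -/
def poisson (x : M) (α β : CoT E x) : ℝ := Ω.form.1 x ![Ω.sharp x α, Ω.sharp x β]

/-- The Poisson bracket `{f, g} = ⟨df ∧ dg, Π⟩`. -/
def bracket (f g : M → ℝ) (x : M) : ℝ := Ω.poisson x (dAt f x) (dAt g x)

/-- `♯_k : ∧ᵏT_x^*M → ∧ᵏT_xM`, the `k`-th exterior power of `♯`. A `k`-vector is regarded as an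
alternating form on covectors through `⟨α₁ ∧ ⋯ ∧ α_k, X₁ ∧ ⋯ ∧ X_k⟩ = det (αᵢ(Xⱼ))`; the sign
comes from `β(♯α) = -α(♯β)`, see `sharpK_wedge`. -/
def sharpK {k : ℕ} (x : M) (η : T E x [⋀^Fin k]→ₗ[ℝ] ℝ) : CoT E x [⋀^Fin k]→ₗ[ℝ] ℝ :=
  (-1 : ℝ) ^ k • η.compLinearMap (Ω.sharp x)

/-- `♭_k : ∧ᵏT_xM → ∧ᵏT_x^*M`, the `k`-th exterior power of `♭`, see `flatK_wedge`. -/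
def flatK {k : ℕ} (x : M) (A : CoT E x [⋀^Fin k]→ₗ[ℝ] ℝ) : T E x [⋀^Fin k]→ₗ[ℝ] ℝ :=
  (-1 : ℝ) ^ k • A.compLinearMap (Ω.flat x)

theorem flat_sharp (x : M) (α : CoT E x) : Ω.flat x (Ω.sharp x α) = α :=
  (Ω.flatEquiv x).apply_symm_apply α

/-- `♯_k(α₁ ∧ ⋯ ∧ α_k) = ♯α₁ ∧ ⋯ ∧ ♯α_k`. -/
theorem sharpK_wedge {k : ℕ} (x : M) (α : Fin k → CoT E x) :
    Ω.sharpK x (wedge α) = wedge (fun i => Module.Dual.eval ℝ (T E x) (Ω.sharp x (α i))) := by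
  ext β
  have h : ∀ a b : CoT E x, b (Ω.sharp x a) = - a (Ω.sharp x b) := fun a b => by
    have h := Ω.flat_swap x (Ω.sharp x b) (Ω.sharp x a)
    rwa [flat_sharp, flat_sharp] at h
  have e : (fun i => LinearMap.pi (fun j => Module.Dual.eval ℝ (T E x) (Ω.sharp x (α j))) (β i))
      = -(Matrix.of fun i j => α j (Ω.sharp x (β i))) := by
    ext i j
    simpa using h (α j) (β i)
  change (-1 : ℝ) ^ k * Matrix.det (Matrix.of fun i j => α j (Ω.sharp x (β i)))
    = Matrix.det (fun i => LinearMap.pi (fun j => Module.Dual.eval ℝ (T E x) (Ω.sharp x (α j)))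
      (β i))
  rw [e, Matrix.det_neg, Fintype.card_fin]

/-- `♭_k(X₁ ∧ ⋯ ∧ X_k) = ♭X₁ ∧ ⋯ ∧ ♭X_k`. -/
theorem flatK_wedge {k : ℕ} (x : M) (X : Fin k → T E x) :
    Ω.flatK x (wedge (fun i => Module.Dual.eval ℝ (T E x) (X i)))
      = wedge (fun i => Ω.flat x (X i)) := by
  ext v
  have e : (fun i => LinearMap.pi (fun j => Ω.flat x (X j)) (v i))
      = -(Matrix.of fun i j => Ω.flat x (v i) (X j)) := by
    ext i j
    simpa using Ω.flat_swap x (X j) (v i)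
  change (-1 : ℝ) ^ k * Matrix.det (Matrix.of fun i j => Ω.flat x (v i) (X j))
    = Matrix.det (fun i => LinearMap.pi (fun j => Ω.flat x (X j)) (v i))
  rw [e, Matrix.det_neg, Fintype.card_fin]

/-- The bracket `[α, β]_Π = L_{♯α} β - L_{♯β} α + d⟨α ∧ β, Π⟩`, evaluated on `Y`. -/
def formBracket (α β : ∀ x : M, CoT E x) (Y : ∀ x : M, T E x) (x : M) : ℝ :=
  lieDeriv (fun z => Ω.sharp z (α z)) β Y x - lieDeriv (fun z => Ω.sharp z (β z)) α Y x
    + dAt (E := E) (fun z => Ω.poisson z (α z) (β z)) x (Y x)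

/-! ### Brylinski's operator -/

/-- The second sum in `deltaOn`; it is empty on forms of degree one. The pairs `i < j` of indices
are the pairs `i.castSucc < j`, and `l ↦ j.succAbove (i.succAbove l)` enumerates the remaining
indices in increasing order. -/
def deltaOnSnd : {k : ℕ} → (φ₀ : M → ℝ) → (φ : Fin (k + 1) → M → ℝ) → (x : M) →
    T E x [⋀^Fin k]→ₗ[ℝ] ℝ
  | 0, _, _, _ => 0
  | k + 1, φ₀, φ, x =>
    ∑ j : Fin (k + 2), ∑ i : Fin (k + 1),
      if i.castSucc < j then
        ((-1 : ℝ) ^ ((i : ℕ) + (j : ℕ)) * φ₀ x) •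
          wedge (Fin.cons (α := fun _ => CoT E x)
            (dAt (Ω.bracket (φ i.castSucc) (φ j)) x)
            (fun l : Fin k => dAt (φ (j.succAbove (i.succAbove l))) x))
      else 0

/-- Brylinski's expression for `δ(φ₀ dφ₁ ∧ ⋯ ∧ dφ_{k+1})`:
`∑ᵢ (-1)^{i+1} {φ₀, φᵢ} dφ₁ ∧ ⋯ d̂φᵢ ⋯ ∧ dφ_{k+1}
  + ∑_{i<j} (-1)^{i+j} φ₀ d{φᵢ, φⱼ} ∧ dφ₁ ∧ ⋯ d̂φᵢ ⋯ d̂φⱼ ⋯ ∧ dφ_{k+1}`.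
The functions `φ₁, …, φ_{k+1}` are indexed from `0` in the code. -/
def deltaOn {k : ℕ} (φ₀ : M → ℝ) (φ : Fin (k + 1) → M → ℝ) (x : M) :
    T E x [⋀^Fin k]→ₗ[ℝ] ℝ :=
  ∑ i : Fin (k + 1), ((-1 : ℝ) ^ (i : ℕ) * Ω.bracket φ₀ (φ i) x) •
      wedge (fun j : Fin k => dAt (φ (i.succAbove j)) x)
    + Ω.deltaOnSnd φ₀ φ x

open Classical in
/-- The canonical (Poisson homology) boundary operator `δ : Ω^{k+1}(M) → Ω^k(M)` at a point `x`:
the alternating form to which `deltaOn` extends by linearity, that is, the one which equals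
`∑ₛ δ(φ₀ˢ dφ₁ˢ ∧ ⋯ ∧ dφ_{k+1}ˢ)` at `x` for every representation
`η = ∑ₛ φ₀ˢ dφ₁ˢ ∧ ⋯ ∧ dφ_{k+1}ˢ` near `x`. -/
def delta {k : ℕ} (η : Form E M (k + 1)) (x : M) : T E x [⋀^Fin k]→ₗ[ℝ] ℝ :=
  if h : ∃ B : T E x [⋀^Fin k]→ₗ[ℝ] ℝ,
      ∀ (n : ℕ) (φ₀ : Fin n → C^∞⟮𝓘(ℝ, E), M; ℝ⟯)
        (φ : Fin n → Fin (k + 1) → C^∞⟮𝓘(ℝ, E), M; ℝ⟯),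
        (∀ᶠ z in 𝓝 x, η.1 z = ∑ s, φ₀ s z • wedge (fun j => dAt (φ s j) z)) →
        B = ∑ s, Ω.deltaOn (φ₀ s) (fun j => φ s j) x
  then h.choose else 0

end SymplecticForm

variable [FiniteDimensional ℝ E]

/-- A contravariant derivative `D : Ω¹(M) → Γ(TM ⊗ T^*M)`, with `TM ⊗ T^*M` identified with
`Hom(T^*M, T^*M)` by `⟨η, X ⊗ α⟩ = η(X) α`; `D α x h` is the value of `D_h α` at `x`. -/
structure ContravariantDerivative (Ω : SymplecticForm E M) where
  toLin : OneForm E M →ₗ[ℝ] (∀ x : M, CoT E x →ₗ[ℝ] CoT E x)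
  smooth : ∀ α β : OneForm E M, (fun x => toLin α x (β.1 x)) ∈ OneForm E M
  leibniz : ∀ (f : C^∞⟮𝓘(ℝ, E), M; ℝ⟯) (α : OneForm E M) (x : M) (h : CoT E x),
    toLin (OneForm.fsmul f α) x h = f x • toLin α x h + dAt f x (Ω.sharp x h) • α.1 x

namespace ContravariantDerivative

variable {Ω : SymplecticForm E M} (D : ContravariantDerivative Ω)

/-- `D` is a Poisson connection:
`(♯α)⟨β ∧ γ, Π⟩ = ⟨D_α β ∧ γ, Π⟩ + ⟨β ∧ D_α γ, Π⟩`. -/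
def IsPoisson : Prop :=
  ∀ (α β γ : OneForm E M) (x : M),
    dAt (E := E) (fun z => Ω.poisson z (β.1 z) (γ.1 z)) x (Ω.sharp x (α.1 x))
      = Ω.poisson x (D.toLin β x (α.1 x)) (γ.1 x) + Ω.poisson x (β.1 x) (D.toLin γ x (α.1 x))

/-- The torsion `T_D(α, β) = D_α β - D_β α - [α, β]_Π` vanishes. -/
def IsTorsionFree : Prop :=
  ∀ (α β : OneForm E M) (Y : ∀ x : M, T E x), IsSmoothVF Y → ∀ x : M,
    (D.toLin β x (α.1 x) - D.toLin α x (β.1 x)) (Y x) = Ω.formBracket α.1 β.1 Y x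

open Classical in
/-- The extension of `D` to `k`-vector fields: `D_h A` at `x` is the `k`-vector with
`⟨α₁ ∧ ⋯ ∧ α_k, D_h A⟩ = (♯h)⟨α₁ ∧ ⋯ ∧ α_k, A⟩ - ∑ᵢ ⟨α₁ ∧ ⋯ ∧ D_h αᵢ ∧ ⋯ ∧ α_k, A⟩`
for all smooth `1`-forms `αᵢ`. -/
def multi {k : ℕ} (A : ∀ x : M, CoT E x [⋀^Fin k]→ₗ[ℝ] ℝ) (x : M) (h : CoT E x) :
    CoT E x [⋀^Fin k]→ₗ[ℝ] ℝ :=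
  if H : ∃ B : CoT E x [⋀^Fin k]→ₗ[ℝ] ℝ, ∀ α : Fin k → OneForm E M,
      B (fun i => (α i).1 x) =
        dAt (E := E) (fun z => A z (fun i => (α i).1 z)) x (Ω.sharp x h)
          - ∑ i, A x (Function.update (fun j => (α j).1 x) i (D.toLin (α i) x h))
  then H.choose else 0

/-- The connection induced by `D` on `k`-forms: `∇_v η = (♭_k ∘ D_{♭v} ∘ ♯_k) η`. -/
def nabla {k : ℕ} (η : Form E M k) (x : M) (v : T E x) : T E x [⋀^Fin k]→ₗ[ℝ] ℝ :=
  Ω.flatK x (D.multi (fun z => Ω.sharpK z (η.1 z)) x (Ω.flat x v))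

end ContravariantDerivative

end Fields

end Symp

end

namespace Symp

/-! ### Exterior products of covectors, their contractions, and sums over pairs of factors. -/

section LinearAlgebra

variable {V : Type*} [AddCommGroup V] [Module ℝ V]

/-! Near a point, write η as a sum of terms φ₀ dφ₁ ∧ ⋯ ∧ dφ_k. Because D preserves Π, it commutes
with ♯, so ∇_{♯h} acts on such a sum by the Leibniz rule with D_h on each dφⱼ
(`IsPoisson.nabla_sharp`). It remains to contract ∇_{♯θⁱ}η with eᵢ and sum over i.

Differentiating φ₀ yields the terms ±{φ₀, φⱼ}, since ∑ᵢ dφⱼ(eᵢ) ♯θⁱ = ♯dφⱼ. When dφⱼ is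
differentiated and eᵢ enters that same factor, the result is the trace ∑ᵢ (D_{θⁱ} dφⱼ)(eᵢ). It
vanishes because it pairs the symmetric Hessian (`hessian_symm`) with the antisymmetric ω
(`sum_toLin_d_apply`). When eᵢ enters another factor dφ_p, the sum over i turns D_{θⁱ} dφⱼ into
D_{dφ_p} dφⱼ. The two contributions of a pair combine to a difference that zero torsion identifies
with d{φᵢ, φⱼ} (`IsTorsionFree.d`).

The contraction depends only on η, while the Brylinski expression is written in a representation.
Their equality for every representation (`sum_curryLeft_nabla`) therefore proves both that δ is well
defined and the formula for it. -/

theorem wedge_apply {k : ℕ} (l : Fin k → Module.Dual ℝ V) (v : Fin k → V) :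
    wedge l v = Matrix.det (Matrix.of fun i j => l j (v i)) := rfl

/-- The exterior product of covectors is alternating in its factors. -/
theorem wedge_apply_eq_compLinearMap {k : ℕ} (l : Fin k → Module.Dual ℝ V) (v : Fin k → V) :
    wedge l v = Matrix.detRowAlternating.compLinearMap
      (LinearMap.pi fun j => Module.Dual.eval ℝ V (v j)) l := by
  rw [wedge_apply, ← Matrix.det_transpose]
  rfl

theorem wedge_update_add {k : ℕ} (l : Fin k → Module.Dual ℝ V) (i : Fin k)
    (a b : Module.Dual ℝ V) :
    wedge (Function.update l i (a + b))
      = wedge (Function.update l i a) + wedge (Function.update l i b) := by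
  ext v
  simp only [AlternatingMap.add_apply, wedge_apply_eq_compLinearMap, AlternatingMap.map_update_add]

theorem wedge_update_smul {k : ℕ} (l : Fin k → Module.Dual ℝ V) (i : Fin k)
    (c : ℝ) (a : Module.Dual ℝ V) :
    wedge (Function.update l i (c • a)) = c • wedge (Function.update l i a) := by
  ext v
  simp only [AlternatingMap.smul_apply, wedge_apply_eq_compLinearMap,
    AlternatingMap.map_update_smul]

theorem wedge_update_sum {k : ℕ} (l : Fin k → Module.Dual ℝ V) (i : Fin k)
    {ι : Type*} (s : Finset ι) (a : ι → Module.Dual ℝ V) :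
    wedge (Function.update l i (∑ b ∈ s, a b)) = ∑ b ∈ s, wedge (Function.update l i (a b)) := by
  let L : Module.Dual ℝ V →ₗ[ℝ] (V [⋀^Fin k]→ₗ[ℝ] ℝ) :=
    { toFun := fun a => wedge (Function.update l i a)
      map_add' := wedge_update_add l i
      map_smul' := wedge_update_smul l i }
  exact map_sum L a s

theorem wedge_cons_sub {k : ℕ} (l : Fin k → Module.Dual ℝ V) (a b : Module.Dual ℝ V) :
    wedge (Fin.cons (α := fun _ => Module.Dual ℝ V) (a - b) l)
      = wedge (Fin.cons (α := fun _ => Module.Dual ℝ V) a l)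
        - wedge (Fin.cons (α := fun _ => Module.Dual ℝ V) b l) := by
  have h (c) : Function.update (Fin.cons (α := fun _ => Module.Dual ℝ V) a l) 0 c
      = Fin.cons (α := fun _ => Module.Dual ℝ V) c l := Fin.update_cons_zero ..
  have hs := wedge_update_add (Fin.cons (α := fun _ => Module.Dual ℝ V) a l) 0 (a - b) b
  rw [sub_add_cancel] at hs
  simp only [h] at hs
  exact eq_sub_of_add_eq hs.symm

/-- Moving a factor of an exterior product to the front. -/
theorem wedge_update {k : ℕ} (l : Fin (k + 1) → Module.Dual ℝ V) (i : Fin (k + 1))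
    (a : Module.Dual ℝ V) :
    wedge (Function.update l i a) = (-1 : ℝ) ^ (i : ℕ) •
      wedge (Fin.cons (α := fun _ => Module.Dual ℝ V) a fun j => l (i.succAbove j)) := by
  ext v
  have h : Function.update l i a = i.insertNth (α := fun _ => Module.Dual ℝ V) a
      (fun j => l (i.succAbove j)) := by
    rw [← Fin.insertNth_removeNth]; rfl
  rw [h, AlternatingMap.smul_apply, wedge_apply_eq_compLinearMap, wedge_apply_eq_compLinearMap,
    AlternatingMap.map_insertNth, ← Int.cast_smul_eq_zsmul ℝ]
  push_cast
  rfl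

theorem alternating_sum_apply {W : Type*} [AddCommGroup W] [Module ℝ W] {k : ℕ} {ι : Type*}
    (s : Finset ι) (f : ι → W [⋀^Fin k]→ₗ[ℝ] ℝ) (v : Fin k → W) :
    (∑ i ∈ s, f i) v = ∑ i ∈ s, f i v :=
  map_sum (⟨⟨fun f => f v, rfl⟩, fun _ _ => rfl⟩ : (W [⋀^Fin k]→ₗ[ℝ] ℝ) →+ ℝ) f s

/-- Contraction of an exterior product with a vector. -/
theorem curryLeft_wedge {k : ℕ} (l : Fin (k + 1) → Module.Dual ℝ V) (v : V) :
    (wedge l).curryLeft v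
      = ∑ j : Fin (k + 1), ((-1 : ℝ) ^ (j : ℕ) * l j v) • wedge (fun i => l (j.succAbove i)) := by
  ext w
  rw [AlternatingMap.curryLeft_apply_apply, wedge_apply, Matrix.det_succ_row_zero]
  rw [alternating_sum_apply]
  rfl

/-- An ordered pair of distinct indices is `(p, p.succAbove q)`. For `i ≤ q`, the entries
`(i.castSucc, q)` and `(q.succ, i)` encode the two orderings of the pair `i < q + 1`. -/
theorem sum_sum_succAbove {A : Type*} [AddCommMonoid A] {k : ℕ} (F G : Fin (k + 2) → Fin (k + 1) → A)
    (h : ∀ i q : Fin (k + 1), i ≤ q → F i.castSucc q + F q.succ i = G q.succ i) :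
    ∑ p, ∑ q, F p q = ∑ j, ∑ i, if i.castSucc < j then G j i else 0 := by
  have h1 : ∑ p, ∑ q, F p q = (∑ p, ∑ q : Fin (k + 1), if q.castSucc < p then F p q else 0)
      + ∑ p, ∑ q : Fin (k + 1), if q.castSucc < p then 0 else F p q := by
    simp only [← Finset.sum_add_distrib]
    refine Finset.sum_congr rfl fun p _ => Finset.sum_congr rfl fun q _ => ?_
    split_ifs <;> simp
  have h2 : (∑ p, ∑ q : Fin (k + 1), if q.castSucc < p then 0 else F p q)
      = ∑ q : Fin (k + 1), ∑ i : Fin (k + 1), if i ≤ q then F i.castSucc q else 0 := by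
    rw [Finset.sum_comm]
    refine Finset.sum_congr rfl fun q _ => ?_
    -- The last index is never the smaller of a pair, so its term drops; dually, index 0 is never
    -- the larger.
    rw [Fin.sum_univ_castSucc, if_pos (Fin.castSucc_lt_last q), add_zero]
    refine Finset.sum_congr rfl fun i _ => ?_
    by_cases h3 : i ≤ q
    · rw [if_pos h3, if_neg (by simpa using h3)]
    · rw [if_neg h3, if_pos (by simpa using h3)]
  rw [h1, h2, Fin.sum_univ_succ, Fin.sum_univ_succ (n := k + 1)]
  simp only [Fin.not_lt_zero, if_false, Finset.sum_const_zero, zero_add, Fin.castSucc_lt_succ_iff]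
  simp only [← Finset.sum_add_distrib]
  refine Finset.sum_congr rfl fun q _ => Finset.sum_congr rfl fun i _ => ?_
  split_ifs with hi
  · rw [← h i q hi, add_comm]
  · simp

/-- The remaining indices do not depend on which member of the pair is removed first. -/
theorem succ_succAbove_succAbove {k : ℕ} {i q : Fin (k + 1)} (h : i ≤ q) (l : Fin k) :
    q.succ.succAbove (i.succAbove l) = i.castSucc.succAbove (q.succAbove l) := by
  ext
  simp only [Fin.succAbove, Fin.lt_def, Fin.le_def] at *
  split_ifs <;> simp_all <;> omega

theorem sum_apply_smul_dual {N : ℕ} {e : Fin N → V} {θ : Fin N → Module.Dual ℝ V}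
    (he : ∀ v, ∑ i, θ i v • e i = v) (l : Module.Dual ℝ V) : ∑ i, l (e i) • θ i = l := by
  ext v
  conv_rhs => rw [← he v, map_sum]
  simp [LinearMap.sum_apply, mul_comm]

/-- The contraction `∑ᵢ i(eᵢ) T_{θⁱ}` of a derivation `T` of exterior products all of whose traces
`∑ᵢ (T_{θⁱ} l)(eᵢ)` vanish. -/
theorem sum_curryLeft_wedge_update {N k : ℕ} {e : Fin N → V} {θ : Fin N → Module.Dual ℝ V}
    (he : ∀ v, ∑ i, θ i v • e i = v) (l : Fin (k + 1) → Module.Dual ℝ V)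
    (T : Fin (k + 1) → Module.Dual ℝ V →ₗ[ℝ] Module.Dual ℝ V)
    (hT : ∀ j, ∑ i, T j (θ i) (e i) = 0) :
    ∑ i, ∑ j, (wedge (Function.update l j (T j (θ i)))).curryLeft (e i)
      = ∑ p : Fin (k + 1), ∑ q : Fin k, (-1 : ℝ) ^ (p : ℕ) •
          wedge (Function.update (fun b => l (p.succAbove b)) q (T (p.succAbove q) (l p))) := by
  simp only [curryLeft_wedge]
  rw [Finset.sum_congr rfl fun i _ => Finset.sum_comm, Finset.sum_comm]
  refine Finset.sum_congr rfl fun p _ => ?_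
  rw [Finset.sum_comm, Fin.sum_univ_succAbove _ p]
  -- The vector enters the very factor that was differentiated: this is the trace.
  have h0 : ∑ i, ((-1 : ℝ) ^ (p : ℕ) * Function.update l p (T p (θ i)) p (e i)) •
      wedge (fun b => Function.update l p (T p (θ i)) (p.succAbove b)) = 0 := by
    simp only [Function.update_self, Function.update_of_ne (Fin.succAbove_ne p _)]
    rw [← Finset.sum_smul, ← Finset.mul_sum, hT, mul_zero, zero_smul]
  rw [h0, zero_add]
  refine Finset.sum_congr rfl fun q _ => ?_
  have h1 (w : Module.Dual ℝ V) : (fun b => Function.update l (p.succAbove q) w (p.succAbove b))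
      = Function.update (fun b => l (p.succAbove b)) q w :=
    Function.update_comp_eq_of_injective l Fin.succAbove_right_injective q w
  simp only [h1, Function.update_of_ne (Fin.succAbove_ne p q).symm]
  -- The vector enters a different factor `l p`; expanding `l p` in the coframe absorbs the sum over
  -- the frame.
  conv_rhs => rw [← sum_apply_smul_dual he (l p), map_sum, wedge_update_sum, Finset.smul_sum]
  refine Finset.sum_congr rfl fun i _ => ?_
  rw [map_smul, wedge_update_smul, smul_smul]

/-- The sum over ordered pairs in `sum_curryLeft_wedge_update` as a sum over pairs `i < j`. -/
theorem sum_sum_wedge_update_succAbove {k : ℕ} (l : Fin (k + 2) → Module.Dual ℝ V)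
    (T : Fin (k + 2) → Module.Dual ℝ V →ₗ[ℝ] Module.Dual ℝ V)
    (b : Fin (k + 2) → Fin (k + 2) → Module.Dual ℝ V)
    (hb : ∀ i j, T i (l j) - T j (l i) = b i j) :
    ∑ p : Fin (k + 2), ∑ q : Fin (k + 1), (-1 : ℝ) ^ (p : ℕ) •
        wedge (Function.update (fun b => l (p.succAbove b)) q (T (p.succAbove q) (l p)))
      = ∑ j : Fin (k + 2), ∑ i : Fin (k + 1), if i.castSucc < j then
          (-1 : ℝ) ^ ((i : ℕ) + (j : ℕ)) • wedge (Fin.cons (α := fun _ => Module.Dual ℝ V)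
            (b i.castSucc j) fun a => l (j.succAbove (i.succAbove a))) else 0 := by
  refine sum_sum_succAbove _ (fun j i => (-1 : ℝ) ^ ((i : ℕ) + (j : ℕ)) •
    wedge (Fin.cons (α := fun _ => Module.Dual ℝ V)
            (b i.castSucc j) fun a => l (j.succAbove (i.succAbove a)))) fun i q hiq => ?_
  have h1 : i.castSucc.succAbove q = q.succ :=
    Fin.succAbove_of_le_castSucc _ _ (by simpa using hiq)
  have h2 : q.succ.succAbove i = i.castSucc :=
    Fin.succAbove_of_castSucc_lt _ _ (by simpa [Fin.castSucc_lt_succ_iff] using hiq)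
  simp only [wedge_update, h1, h2, succ_succAbove_succAbove hiq, ← hb, wedge_cons_sub, smul_smul,
    Fin.val_castSucc, Fin.val_succ, ← pow_add]
  -- The larger index is `q + 1`, so the two orderings carry opposite signs and assemble the
  -- difference.
  rw [smul_sub, show (i : ℕ) + (q + 1) = (i + q) + 1 by ring,
    show (q : ℕ) + 1 + i = (i + q) + 1 by ring, pow_succ]
  module

end LinearAlgebra

end Symp

namespace Symp

/-! ### Differentials of sums, products and determinants. -/

section Calculus

variable {E : Type*} [NormedAddCommGroup E] [NormedSpace ℝ E]
  {M : Type*} [TopologicalSpace M] [ChartedSpace E M] {x : M}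

theorem dAt_congr {f g : M → ℝ} (h : f =ᶠ[𝓝 x] g) : dAt (E := E) f x = dAt g x := by
  have h' := h.mfderiv_eq (I := 𝓘(ℝ, E)) (I' := 𝓘(ℝ, ℝ))
  ext v
  exact congrArg (fun L : E →L[ℝ] ℝ => L v) h'

theorem dAt_const (c : ℝ) : dAt (E := E) (fun _ : M => c) x = 0 := by
  simp [dAt, mvfderiv_const]

theorem dAt_add {f g : M → ℝ} (hf : MDifferentiableAt 𝓘(ℝ, E) 𝓘(ℝ, ℝ) f x)
    (hg : MDifferentiableAt 𝓘(ℝ, E) 𝓘(ℝ, ℝ) g x) :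
    dAt (E := E) (fun z => f z + g z) x = dAt f x + dAt g x := by
  simp [dAt, mvfderiv_fun_add hf hg]

theorem dAt_mul {f g : M → ℝ} (hf : MDifferentiableAt 𝓘(ℝ, E) 𝓘(ℝ, ℝ) f x)
    (hg : MDifferentiableAt 𝓘(ℝ, E) 𝓘(ℝ, ℝ) g x) :
    dAt (E := E) (fun z => f z * g z) x = f x • dAt g x + g x • dAt f x := by
  simp [dAt, mvfderiv_fun_mul hf hg]

theorem dAt_const_mul (c : ℝ) {f : M → ℝ} (hf : MDifferentiableAt 𝓘(ℝ, E) 𝓘(ℝ, ℝ) f x) :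
    dAt (E := E) (fun z => c * f z) x = c • dAt f x := by
  rw [dAt_mul mdifferentiableAt_const hf, dAt_const, smul_zero, add_zero]

theorem dAt_neg (f : M → ℝ) : dAt (E := E) (fun z => - f z) x = - dAt f x := by
  simp [dAt, mvfderiv_fun_neg]

theorem mdifferentiableAt_finset_sum {ι : Type*} (s : Finset ι) {f : ι → M → ℝ}
    (hf : ∀ i ∈ s, MDifferentiableAt 𝓘(ℝ, E) 𝓘(ℝ, ℝ) (f i) x) :
    MDifferentiableAt 𝓘(ℝ, E) 𝓘(ℝ, ℝ) (fun z => ∑ i ∈ s, f i z) x := by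
  classical
  induction s using Finset.induction_on with
  | empty => simpa using mdifferentiableAt_const
  | insert i s hi ih =>
    simp only [Finset.sum_insert hi]
    exact (hf i (by simp)).add (ih fun j hj => hf j (by simp [hj]))

theorem mdifferentiableAt_finset_prod {ι : Type*} (s : Finset ι) {f : ι → M → ℝ}
    (hf : ∀ i ∈ s, MDifferentiableAt 𝓘(ℝ, E) 𝓘(ℝ, ℝ) (f i) x) :
    MDifferentiableAt 𝓘(ℝ, E) 𝓘(ℝ, ℝ) (fun z => ∏ i ∈ s, f i z) x := by
  classical
  induction s using Finset.induction_on with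
  | empty => simpa using mdifferentiableAt_const
  | insert i s hi ih =>
    simp only [Finset.prod_insert hi]
    exact (hf i (by simp)).mul (ih fun j hj => hf j (by simp [hj]))

theorem dAt_sum {ι : Type*} (s : Finset ι) {f : ι → M → ℝ}
    (hf : ∀ i ∈ s, MDifferentiableAt 𝓘(ℝ, E) 𝓘(ℝ, ℝ) (f i) x) :
    dAt (E := E) (fun z => ∑ i ∈ s, f i z) x = ∑ i ∈ s, dAt (f i) x := by
  classical
  induction s using Finset.induction_on with
  | empty => simpa using dAt_const 0
  | insert i s hi ih =>
    simp only [Finset.sum_insert hi]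
    rw [dAt_add (hf i (by simp))
      (mdifferentiableAt_finset_sum s fun j hj => hf j (by simp [hj])),
      ih fun j hj => hf j (by simp [hj])]

theorem dAt_prod {ι : Type*} [DecidableEq ι] (s : Finset ι) {f : ι → M → ℝ}
    (hf : ∀ i ∈ s, MDifferentiableAt 𝓘(ℝ, E) 𝓘(ℝ, ℝ) (f i) x) :
    dAt (E := E) (fun z => ∏ i ∈ s, f i z) x
      = ∑ i ∈ s, (∏ j ∈ s.erase i, f j x) • dAt (f i) x := by
  induction s using Finset.induction_on with
  | empty => simpa using dAt_const 1
  | insert i s hi ih =>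
    simp only [Finset.prod_insert hi, Finset.sum_insert hi]
    rw [dAt_mul (hf i (by simp))
      (mdifferentiableAt_finset_prod s fun j hj => hf j (by simp [hj])),
      ih fun j hj => hf j (by simp [hj]), Finset.erase_insert hi, add_comm, Finset.smul_sum]
    congr 1
    refine Finset.sum_congr rfl fun j hj => ?_
    have hij : i ≠ j := fun h => hi (h ▸ hj)
    rw [Finset.erase_insert_of_ne hij, Finset.prod_insert (by simp [hi]), smul_smul]

/-- The derivative of a determinant, by columns. -/
theorem dAt_det {k : ℕ} {P : Fin k → Fin k → M → ℝ}
    (hP : ∀ i j, MDifferentiableAt 𝓘(ℝ, E) 𝓘(ℝ, ℝ) (P i j) x) (v : T E x) :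
    dAt (E := E) (fun z => Matrix.det (Matrix.of fun i j => P i j z)) x v
      = ∑ j, Matrix.det (Matrix.updateCol (Matrix.of fun i j => P i j x) j
          fun i => dAt (P i j) x v) := by
  have hm (σ : Equiv.Perm (Fin k)) : MDifferentiableAt 𝓘(ℝ, E) 𝓘(ℝ, ℝ)
      (fun z => ((Equiv.Perm.sign σ : ℤ) : ℝ) * ∏ i, P (σ i) i z) x :=
    mdifferentiableAt_const.mul (mdifferentiableAt_finset_prod _ fun i _ => hP _ _)
  simp only [Matrix.det_apply', Matrix.of_apply]
  rw [dAt_sum _ fun σ _ => hm σ, LinearMap.sum_apply, Finset.sum_comm]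
  refine Finset.sum_congr rfl fun σ _ => ?_
  rw [dAt_const_mul _ (mdifferentiableAt_finset_prod _ fun i _ => hP _ _),
    dAt_prod _ fun i _ => hP _ _, LinearMap.smul_apply, LinearMap.sum_apply, Finset.smul_sum]
  refine Finset.sum_congr rfl fun j _ => ?_
  rw [← Finset.mul_prod_erase _ _ (Finset.mem_univ j), Matrix.updateCol_self,
    LinearMap.smul_apply, smul_eq_mul, smul_eq_mul, mul_comm (∏ _ ∈ _, _)]
  congr 2
  refine Finset.prod_congr rfl fun i hi => ?_
  rw [Matrix.updateCol_ne (Finset.ne_of_mem_erase hi), Matrix.of_apply]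

theorem mdifferentiableAt_det {k : ℕ} {P : Fin k → Fin k → M → ℝ}
    (hP : ∀ i j, MDifferentiableAt 𝓘(ℝ, E) 𝓘(ℝ, ℝ) (P i j) x) :
    MDifferentiableAt 𝓘(ℝ, E) 𝓘(ℝ, ℝ) (fun z => Matrix.det (Matrix.of fun i j => P i j z)) x := by
  simp only [Matrix.det_apply', Matrix.of_apply]
  exact mdifferentiableAt_finset_sum _ fun σ _ => mdifferentiableAt_const.mul
    (mdifferentiableAt_finset_prod _ fun i _ => hP _ _)

/-- By Cramer's rule both sides equal the trace of `P.adjugate * R`. This moves derivatives from the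
factors of an exterior product (columns) to its arguments (rows). -/
theorem sum_det_updateCol_eq_sum_det_updateRow {k : ℕ} (P R : Matrix (Fin k) (Fin k) ℝ) :
    ∑ j, (P.updateCol j fun i => R i j).det = ∑ i, (P.updateRow i (R i)).det := by
  have h1 (j : Fin k) : (P.updateCol j fun i => R i j).det = ∑ i, P.adjugate j i * R i j := by
    rw [← Matrix.cramer_apply, Matrix.cramer_eq_adjugate_mulVec]; rfl
  have h2 (i : Fin k) : (P.updateRow i (R i)).det = ∑ j, P.adjugate j i * R i j := by
    rw [← Matrix.cramer_transpose_apply, Matrix.cramer_eq_adjugate_mulVec,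
      ← Matrix.adjugate_transpose]; rfl
  simp only [h1, h2]
  exact Finset.sum_comm

variable [IsManifold 𝓘(ℝ, E) ∞ M]

theorem contMDiff_dAt_apply {f : M → ℝ} (hf : ContMDiff 𝓘(ℝ, E) 𝓘(ℝ, ℝ) ∞ f)
    {X : ∀ x : M, T E x} (hX : IsSmoothVF X) :
    ContMDiff 𝓘(ℝ, E) 𝓘(ℝ, ℝ) ∞ (fun x => dAt f x (X x)) := by
  have h1 := (hf.contMDiff_tangentMap (m := ∞) (by simp)).comp hX
  exact (contMDiff_snd_tangentBundle_modelSpace ℝ 𝓘(ℝ, ℝ)).comp h1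

/-- The differential of a smooth function, as a smooth `1`-form. -/
noncomputable def OneForm.d (f : C^∞⟮𝓘(ℝ, E), M; ℝ⟯) : OneForm E M :=
  ⟨fun x => dAt f x, fun _ hX => contMDiff_dAt_apply f.contMDiff hX⟩

theorem IsSmoothVF.sum {ι : Type*} (s : Finset ι) {X : ι → ∀ x : M, T E x}
    (hX : ∀ i ∈ s, IsSmoothVF (X i)) : IsSmoothVF fun x => ∑ i ∈ s, X i x :=
  ContMDiff.sum_section hX

theorem IsSmoothVF.const_smul (c : ℝ) {X : ∀ x : M, T E x} (hX : IsSmoothVF X) :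
    IsSmoothVF fun x => c • X x :=
  ContMDiff.const_smul_section hX

end Calculus

end Symp

namespace Symp

/-! ### Globally extended coordinates and the Lie bracket as a commutator. -/

section Coordinates

variable {E : Type*} [NormedAddCommGroup E] [NormedSpace ℝ E]
  {M : Type*} [TopologicalSpace M] [ChartedSpace E M] [IsManifold 𝓘(ℝ, E) ∞ M]

theorem dAt_comp_extChartAt {x₀ z : M} (hz : z ∈ (chartAt E x₀).source) {H : E → ℝ}
    (hH : DifferentiableAt ℝ H (extChartAt 𝓘(ℝ, E) x₀ z)) (v : T E z) :
    dAt (E := E) (fun y => H (extChartAt 𝓘(ℝ, E) x₀ y)) z v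
      = fderiv ℝ H (extChartAt 𝓘(ℝ, E) x₀ z)
          (mfderiv 𝓘(ℝ, E) 𝓘(ℝ, E) (extChartAt 𝓘(ℝ, E) x₀) z v) := by
  have h := mvfderiv_comp_apply (I := 𝓘(ℝ, E)) (I' := 𝓘(ℝ, E)) z hH.mdifferentiableAt
    (mdifferentiableAt_extChartAt (I := 𝓘(ℝ, E)) hz) v
  refine h.trans ?_
  simp only [mvfderiv, mfderiv_eq_fderiv]
  rfl

/-- Near every point there are coordinate functions and coordinate vector fields which extend to
smooth functions and smooth vector fields on the whole manifold. -/
theorem exists_coordinates [FiniteDimensional ℝ E] [T2Space M] (x : M) :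
    ∃ (u : Fin (Module.finrank ℝ E) → C^∞⟮𝓘(ℝ, E), M; ℝ⟯)
      (W : Fin (Module.finrank ℝ E) → ∀ x : M, T E x), (∀ i, IsSmoothVF (W i)) ∧
      ∀ᶠ z in 𝓝 x, (∀ i j, dAt (E := E) (u i) z (W j z) = if i = j then 1 else 0) ∧
        ∀ v : T E z, ∑ i, dAt (E := E) (u i) z v • W i z = v := by
  classical
  let b := Module.finBasis ℝ E
  let ρ : SmoothBumpFunction 𝓘(ℝ, E) x := Classical.arbitrary _
  let τ := trivializationAt E (TangentSpace 𝓘(ℝ, E) : M → Type _) x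
  have hτ : τ.baseSet = (chartAt E x).source := rfl
  have hsmooth (i) : ContMDiff 𝓘(ℝ, E) 𝓘(ℝ, ℝ) ∞
      fun z => ρ z • b.coord i (extChartAt 𝓘(ℝ, E) x z) := by
    refine ρ.contMDiff_smul ?_
    have h1 : ContMDiff 𝓘(ℝ, E) 𝓘(ℝ, ℝ) ∞ (LinearMap.toContinuousLinearMap (b.coord i)) :=
      ContinuousLinearMap.contMDiff _
    exact h1.comp_contMDiffOn (contMDiffOn_extChartAt (I := 𝓘(ℝ, E)))
  refine ⟨fun i => ⟨_, hsmooth i⟩, fun i z => ρ z • τ.localFrame b i z, fun i => ?_, ?_⟩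
  · exact ContMDiffOn.smul_section_of_tsupport ρ.contMDiff.contMDiffOn τ.open_baseSet
      (hτ ▸ ρ.tsupport_subset_chartAt_source) (τ.contMDiffOn_localFrame_baseSet ∞ b i)
  -- Differentials at `z` require the bump function to be 1 on a neighbourhood of `z`, not just at
  -- `z`.
  · filter_upwards [ρ.eventuallyEq_one.eventuallyEq_nhds, chart_source_mem_nhds E x] with z hρ hz
    have hz' : z ∈ τ.baseSet := hz
    have hρz : ρ z = 1 := hρ.eq_of_nhds
    have hW (i) : τ.localFrame b i z = τ.symmL ℝ z (b i) := by
      rw [τ.localFrame_apply_of_mem_baseSet b hz']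
      simp only [Bundle.Trivialization.basisAt, Module.Basis.map_apply]
      exact (τ.symmL_apply hz' _).symm
    have hu (i) (v : T E z) :
        dAt (E := E) (fun z => ρ z • b.coord i (extChartAt 𝓘(ℝ, E) x z)) z v
          = b.coord i (τ.continuousLinearMapAt ℝ z v) := by
      have h1 : (fun z => ρ z • b.coord i (extChartAt 𝓘(ℝ, E) x z)) =ᶠ[𝓝 z]
          fun z => LinearMap.toContinuousLinearMap (b.coord i) (extChartAt 𝓘(ℝ, E) x z) := by
        filter_upwards [hρ] with y hy
        rw [hy]; simp
      rw [dAt_congr h1, dAt_comp_extChartAt hz (ContinuousLinearMap.differentiableAt _),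
        ContinuousLinearMap.fderiv, TangentBundle.continuousLinearMapAt_trivializationAt hz]
      rfl
    refine ⟨fun i j => ?_, fun v => ?_⟩
    · refine (hu i _).trans ?_
      rw [hρz, one_smul, hW, τ.continuousLinearMapAt_symmL hz', b.coord_apply, b.repr_self,
        Finsupp.single_apply]
      simp [eq_comm]
    · have h2 : ∀ i, dAt (E := E) (fun z => ρ z • b.coord i (extChartAt 𝓘(ℝ, E) x z)) z v •
          (ρ z • τ.localFrame b i z)
          = τ.symmL ℝ z (b.repr (τ.continuousLinearMapAt ℝ z v) i • b i) := fun i => by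
        rw [hu, hρz, one_smul, hW, map_smul]; rfl
      refine (Finset.sum_congr rfl fun i _ => h2 i).trans ?_
      rw [← map_sum, b.sum_repr, τ.symmL_continuousLinearMapAt hz']

/-- The second derivatives of `F` cancel by symmetry. -/
theorem fderiv_lieBracket {F : E → ℝ} {V W : E → E} {y : E} (hF : ContDiffAt ℝ 2 F y)
    (hV : DifferentiableAt ℝ V y) (hW : DifferentiableAt ℝ W y) :
    fderiv ℝ F y (VectorField.lieBracket ℝ V W y)
      = fderiv ℝ (fun z => fderiv ℝ F z (W z)) y (V y)
        - fderiv ℝ (fun z => fderiv ℝ F z (V z)) y (W y) := by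
  have hF' : DifferentiableAt ℝ (fderiv ℝ F) y :=
    (hF.fderiv_right (m := 1) (by norm_num)).differentiableAt one_ne_zero
  have hs : fderiv ℝ (fderiv ℝ F) y (V y) (W y) = fderiv ℝ (fderiv ℝ F) y (W y) (V y) :=
    (hF.isSymmSndFDerivAt (by simp)) _ _
  rw [fderiv_clm_apply hF' hW, fderiv_clm_apply hF' hV, VectorField.lieBracket]
  simp [hs]

/-- The pullback of a vector field by the inverse chart is defined through an inverse derivative;
this identifies it with the push-forward by the chart. -/
theorem inverse_mfderivWithin_extChartAt_symm {x z : M} (hz : z ∈ (chartAt E x).source) (v : T E z) :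
    (ContinuousLinearMap.inverse (M := E) (M₂ := E) (mfderivWithin 𝓘(ℝ, E) 𝓘(ℝ, E)
      (extChartAt 𝓘(ℝ, E) x).symm (Set.range 𝓘(ℝ, E)) (extChartAt 𝓘(ℝ, E) x z)) : E →L[ℝ] E) v
      = mfderiv 𝓘(ℝ, E) 𝓘(ℝ, E) (extChartAt 𝓘(ℝ, E) x) z v := by
  have hz' : z ∈ (extChartAt 𝓘(ℝ, E) x).source := by rwa [extChartAt_source]
  have h1 := mfderivWithin_extChartAt_symm_comp_mfderiv_extChartAt' hz'
  have h2 := mfderiv_extChartAt_comp_mfderivWithin_extChartAt_symm' hz'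
  exact congrArg (fun L : E →L[ℝ] E => L v)
    (ContinuousLinearMap.inverse_eq (M := E) (M₂ := E) h1 h2)

/-- The Lie bracket of vector fields is the commutator of derivations. -/
theorem dAt_mlieBracket [FiniteDimensional ℝ E] {x : M} {f : M → ℝ}
    (hf : ContMDiff 𝓘(ℝ, E) 𝓘(ℝ, ℝ) ∞ f) {X Y : ∀ x : M, T E x}
    (hX : MDifferentiableAt 𝓘(ℝ, E) 𝓘(ℝ, E).tangent
      (fun z => (⟨z, X z⟩ : TangentBundle 𝓘(ℝ, E) M)) x)
    (hY : MDifferentiableAt 𝓘(ℝ, E) 𝓘(ℝ, E).tangent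
      (fun z => (⟨z, Y z⟩ : TangentBundle 𝓘(ℝ, E) M)) x) :
    dAt (E := E) f x (VectorField.mlieBracket 𝓘(ℝ, E) X Y x)
      = dAt (E := E) (fun z => dAt f z (Y z)) x (X x)
        - dAt (E := E) (fun z => dAt f z (X z)) x (Y x) := by
  let φ := extChartAt 𝓘(ℝ, E) x
  let F : E → ℝ := fun y => f (φ.symm y)
  let P (X : ∀ x : M, T E x) : E → E := VectorField.mpullbackWithin 𝓘(ℝ, E) 𝓘(ℝ, E) φ.symm X
    (Set.range 𝓘(ℝ, E))
  have hxs : x ∈ (chartAt E x).source := mem_chart_source E x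
  have hF : ∀ y ∈ φ.target, ContDiffAt ℝ 2 F y := fun y hy => by
    have h1 := (contMDiffOn_extChartAt_symm (I := 𝓘(ℝ, E)) (n := ∞) x).contMDiffAt
      ((isOpen_extChartAt_target (I := 𝓘(ℝ, E)) x).mem_nhds hy)
    exact (contMDiffAt_iff_contDiffAt.1 (hf.contMDiffAt.comp y h1)).of_le (by norm_cast)
  have hfF : ∀ z ∈ (chartAt E x).source, f =ᶠ[𝓝 z] fun y => F (φ y) := fun z hz => by
    filter_upwards [(chartAt E x).open_source.mem_nhds hz] with y hy
    exact congrArg f (φ.left_inv (by rwa [extChartAt_source])).symm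
  have hmem : ∀ z ∈ (chartAt E x).source, φ z ∈ φ.target := fun z hz =>
    φ.map_source (by rwa [extChartAt_source])
  have hdf : ∀ z ∈ (chartAt E x).source, ∀ v : T E z, dAt (E := E) f z v
      = fderiv ℝ F (φ z) (mfderiv 𝓘(ℝ, E) 𝓘(ℝ, E) φ z v) := fun z hz v => by
    rw [dAt_congr (hfF z hz)]
    exact dAt_comp_extChartAt hz ((hF _ (hmem z hz)).differentiableAt two_ne_zero) v
  have hP (X : ∀ x : M, T E x) : ∀ z ∈ (chartAt E x).source,
      P X (φ z) = mfderiv 𝓘(ℝ, E) 𝓘(ℝ, E) φ z (X z) := fun z hz => by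
    rw [← inverse_mfderivWithin_extChartAt_symm hz]
    have : φ.symm (φ z) = z := φ.left_inv (by rwa [extChartAt_source])
    exact congrArg (DFunLike.coe (F := E →L[ℝ] E) _) (congrArg (fun y => (X y : E)) this)
  have hPd {X : ∀ x : M, T E x} (hX : MDifferentiableAt 𝓘(ℝ, E) 𝓘(ℝ, E).tangent
      (fun z => (⟨z, X z⟩ : TangentBundle 𝓘(ℝ, E) M)) x) : DifferentiableAt ℝ (P X) (φ x) := by
    have h := MDifferentiableWithinAt.differentiableWithinAt_mpullbackWithin_vectorField
      (I := 𝓘(ℝ, E)) (mdifferentiableWithinAt_univ.2 hX)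
    refine h.differentiableAt ?_
    simp
  have hdd {X Y : ∀ x : M, T E x} (hX : MDifferentiableAt 𝓘(ℝ, E) 𝓘(ℝ, E).tangent
      (fun z => (⟨z, X z⟩ : TangentBundle 𝓘(ℝ, E) M)) x) :
      dAt (E := E) (fun z => dAt f z (X z)) x (Y x)
        = fderiv ℝ (fun y => fderiv ℝ F y (P X y)) (φ x) (P Y (φ x)) := by
    have h1 : (fun z => dAt f z (X z)) =ᶠ[𝓝 x] fun z => (fun y => fderiv ℝ F y (P X y)) (φ z) := by
      filter_upwards [(chartAt E x).open_source.mem_nhds hxs] with z hz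
      rw [hdf z hz, hP X z hz]
    rw [dAt_congr h1, hP Y x hxs]
    refine dAt_comp_extChartAt (H := fun y => fderiv ℝ F y (P X y)) hxs ?_ _
    exact (((hF _ (hmem x hxs)).fderiv_right (m := 1) (by norm_num)).differentiableAt
      one_ne_zero).clm_apply (hPd hX)
  rw [hdd hX, hdd hY, ← fderiv_lieBracket (hF _ (hmem x hxs)) (hPd hX) (hPd hY), hdf x hxs]
  congr 1
  -- The manifold bracket is by definition the bracket of the chart representatives, transported
  -- back.
  rw [← VectorField.mlieBracketWithin_univ, VectorField.mlieBracketWithin_apply]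
  have hinv := isInvertible_mfderiv_extChartAt (I := 𝓘(ℝ, E)) (mem_extChartAt_source (I := 𝓘(ℝ, E)) x)
  refine (hinv.inverse_apply_eq.1 rfl).symm.trans ?_
  have huniv : (extChartAt 𝓘(ℝ, E) x).symm ⁻¹' Set.univ ∩ Set.range 𝓘(ℝ, E) = Set.univ := by simp
  rw [huniv]
  exact congrFun (VectorField.lieBracketWithin_univ (𝕜 := ℝ) (V := P X) (W := P Y)) _

end Coordinates

end Symp

namespace Symp

variable {E : Type*} [NormedAddCommGroup E] [NormedSpace ℝ E] [FiniteDimensional ℝ E]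
  {M : Type*} [TopologicalSpace M] [ChartedSpace E M] [IsManifold 𝓘(ℝ, E) ∞ M]

/-! ### Realizing vectors and covectors at a point by global smooth objects. -/

section Extension

variable [T2Space M]

/-- Every tangent vector extends to a smooth vector field. -/
theorem exists_isSmoothVF_eq {x : M} (v : T E x) : ∃ Y : ∀ x : M, T E x, IsSmoothVF Y ∧ Y x = v := by
  obtain ⟨u, W, hW, h⟩ := exists_coordinates (E := E) x
  exact ⟨fun z => ∑ i, dAt (E := E) (u i) x v • W i z,
    IsSmoothVF.sum _ fun i _ => (hW i).const_smul _, h.self_of_nhds.2 v⟩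

/-- Every covector is the differential of a smooth function. -/
theorem exists_dAt_eq {x : M} (h : CoT E x) : ∃ f : C^∞⟮𝓘(ℝ, E), M; ℝ⟯, dAt (E := E) f x = h := by
  obtain ⟨u, W, hW, hu⟩ := exists_coordinates (E := E) x
  have hs : ContMDiff 𝓘(ℝ, E) 𝓘(ℝ, ℝ) ∞ fun z => ∑ i, h (W i x) * u i z :=
    contMDiff_finsetSum fun i _ => contMDiff_const.mul (u i).contMDiff
  refine ⟨⟨_, hs⟩, ?_⟩
  change dAt (fun z => ∑ i, h (W i x) * u i z) x = h
  refine (dAt_sum _ (f := fun i z => h (W i x) * u i z)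
    fun i _ => mdifferentiableAt_const.mul (u i).mdifferentiableAt).trans ?_
  refine (Finset.sum_congr rfl fun i _ => dAt_const_mul _ (u i).mdifferentiableAt).trans ?_
  ext v
  conv_rhs => rw [← hu.self_of_nhds.2 v, map_sum]
  simp [LinearMap.sum_apply, mul_comm]

end Extension

/-! ### Regularity of ♯ and brackets of exact forms. -/

namespace SymplecticForm

variable (Ω : SymplecticForm E M)

theorem apply_sharp_swap (x : M) (α β : CoT E x) : α (Ω.sharp x β) = - β (Ω.sharp x α) := by
  have h := Ω.flat_swap x (Ω.sharp x α) (Ω.sharp x β)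
  rwa [flat_sharp, flat_sharp] at h

theorem poisson_eq (x : M) (α β : CoT E x) : Ω.poisson x α β = α (Ω.sharp x β) := by
  rw [poisson, ← flat_apply, flat_sharp]

theorem sharp_flat (x : M) (v : T E x) : Ω.sharp x (Ω.flat x v) = v :=
  (Ω.flatEquiv x).symm_apply_apply v

theorem flatK_sharpK {k : ℕ} (x : M) (η : T E x [⋀^Fin k]→ₗ[ℝ] ℝ) :
    Ω.flatK x (Ω.sharpK x η) = η := by
  ext v
  change (-1 : ℝ) ^ k * ((-1 : ℝ) ^ k * η (fun i => Ω.sharp x (Ω.flat x (v i)))) = η v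
  simp only [sharp_flat]
  rw [← mul_assoc, ← mul_pow]
  simp

theorem sharpK_apply {k : ℕ} (x : M) (η : T E x [⋀^Fin k]→ₗ[ℝ] ℝ) (α : Fin k → CoT E x) :
    Ω.sharpK x η α = (-1 : ℝ) ^ k * η (fun i => Ω.sharp x (α i)) := rfl

variable [T2Space M]

/-- Since ♯ is only a pointwise inverse, its regularity must be derived. In coordinates it is, up to
sign, the inverse of the matrix of ω, which Cramer's rule expresses through determinants of smooth
entries. -/
theorem mdifferentiableAt_apply_sharp (α β : OneForm E M) (x : M) :
    MDifferentiableAt 𝓘(ℝ, E) 𝓘(ℝ, ℝ) (fun z => α.1 z (Ω.sharp z (β.1 z))) x := by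
  obtain ⟨u, W, hW, hu⟩ := exists_coordinates (E := E) x
  let n := Module.finrank ℝ E
  let G (z : M) : Matrix (Fin n) (Fin n) ℝ := Matrix.of fun i j => Ω.form.1 z ![W i z, W j z]
  let P (z : M) : Matrix (Fin n) (Fin n) ℝ :=
    Matrix.of fun i j => dAt (E := E) (u i) z (Ω.sharp z (dAt (u j) z))
  have hG (i j) : MDifferentiableAt 𝓘(ℝ, E) 𝓘(ℝ, ℝ) (fun z => G z i j) x := by
    have h := (Ω.form.2 ![W i, W j] (fun a => by fin_cases a <;> exact hW _)).mdifferentiableAt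
      (x := x) (by simp)
    refine h.congr_of_eventuallyEq (Filter.Eventually.of_forall fun z => ?_)
    change Ω.form.1 z _ = Ω.form.1 z _
    congr 1
    funext a
    fin_cases a <;> rfl
  -- The sign comes from ω(Wᵢ, ♯duⱼ) = -duⱼ(Wᵢ).
  have hGP : ∀ᶠ z in 𝓝 x, G z * (-P z) = 1 := by
    filter_upwards [hu] with z hz
    ext i j
    have h1 : ∑ a, G z i a * P z a j = Ω.flat z (W i z) (Ω.sharp z (dAt (u j) z)) := by
      conv_rhs => rw [← hz.2 (Ω.sharp z (dAt (u j) z)), map_sum]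
      refine Finset.sum_congr rfl fun a _ => ?_
      rw [map_smul, smul_eq_mul, mul_comm]
      rfl
    rw [mul_neg, Matrix.neg_apply, Matrix.mul_apply, h1, Ω.flat_swap, flat_sharp, neg_neg, hz.1,
      Matrix.one_apply]
    simp only [eq_comm]
  have hdet : (G x).det ≠ 0 := (Matrix.isUnit_det_of_right_inverse hGP.self_of_nhds).ne_zero
  have hPG : ∀ᶠ z in 𝓝 x, P z = -((G z).det⁻¹ • (G z).adjugate) := by
    filter_upwards [hGP] with z hz
    rw [← neg_neg (P z), ← Matrix.inv_eq_right_inv hz, Matrix.inv_def, Ring.inverse_eq_inv']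
  have hP (i j) : MDifferentiableAt 𝓘(ℝ, E) 𝓘(ℝ, ℝ) (fun z => P z i j) x := by
    have h1 : MDifferentiableAt 𝓘(ℝ, E) 𝓘(ℝ, ℝ) (fun z => (G z).det) x :=
      mdifferentiableAt_det hG
    have h2 : MDifferentiableAt 𝓘(ℝ, E) 𝓘(ℝ, ℝ) (fun z => (G z).det⁻¹) x :=
      (differentiableAt_inv hdet).mdifferentiableAt.comp x h1
    have h3 : MDifferentiableAt 𝓘(ℝ, E) 𝓘(ℝ, ℝ) (fun z => (G z).adjugate i j) x := by
      simp only [Matrix.adjugate_apply]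
      refine mdifferentiableAt_det (P := fun a b z => (G z).updateRow j (Pi.single i 1) a b)
        fun a b => ?_
      by_cases ha : a = j
      · subst ha
        simp only [Matrix.updateRow_self]
        exact mdifferentiableAt_const
      · simp only [Matrix.updateRow_ne ha]
        exact hG a b
    refine (h2.mul h3).neg.congr_of_eventuallyEq ?_
    filter_upwards [hPG] with z hz
    rw [hz]
    rfl
  have hexp : ∀ᶠ z in 𝓝 x, α.1 z (Ω.sharp z (β.1 z))
      = ∑ i, ∑ j, (-(P z j i)) * (β.1 z (W j z) * α.1 z (W i z)) := by
    filter_upwards [hu] with z hz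
    have h1 (i) : dAt (E := E) (u i) z (Ω.sharp z (β.1 z)) = ∑ j, -(P z j i) * β.1 z (W j z) := by
      rw [apply_sharp_swap]
      conv_lhs => rw [← hz.2 (Ω.sharp z (dAt (u i) z)), map_sum]
      rw [← Finset.sum_neg_distrib]
      refine Finset.sum_congr rfl fun j _ => ?_
      rw [map_smul, smul_eq_mul, neg_mul]
      rfl
    conv_lhs => rw [← hz.2 (Ω.sharp z (β.1 z)), map_sum]
    refine Finset.sum_congr rfl fun i _ => ?_
    rw [map_smul, smul_eq_mul, h1, Finset.sum_mul]
    exact Finset.sum_congr rfl fun j _ => mul_assoc _ _ _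
  refine MDifferentiableAt.congr_of_eventuallyEq ?_ hexp
  exact mdifferentiableAt_finset_sum _ fun i _ => mdifferentiableAt_finset_sum _ fun j _ =>
    (hP j i).neg.mul (((β.2 _ (hW j)).mdifferentiableAt (by simp)).mul
      ((α.2 _ (hW i)).mdifferentiableAt (by simp)))

theorem mdifferentiableAt_sharp (β : OneForm E M) (x : M) :
    MDifferentiableAt 𝓘(ℝ, E) 𝓘(ℝ, E).tangent
      (fun z => (⟨z, Ω.sharp z (β.1 z)⟩ : TangentBundle 𝓘(ℝ, E) M)) x := by
  obtain ⟨u, W, hW, hu⟩ := exists_coordinates (E := E) x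
  have h1 : MDifferentiableAt 𝓘(ℝ, E) 𝓘(ℝ, E).tangent (fun z =>
      (⟨z, ∑ i, dAt (E := E) (u i) z (Ω.sharp z (β.1 z)) • W i z⟩ : TangentBundle 𝓘(ℝ, E) M)) x :=
    MDifferentiableAt.sum_section fun i _ =>
      MDifferentiableAt.smul_section (Ω.mdifferentiableAt_apply_sharp (OneForm.d (u i)) β x)
        ((hW i).mdifferentiableAt (by simp))
  refine h1.congr_of_eventuallyEq ?_
  filter_upwards [hu] with z hz
  rw [hz.2]

/-- Cartan's formula on an exact form, L_X dg = d(dg(X)): the bracket term cancels one of the two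
iterated derivatives. -/
theorem lieDeriv_d (α : OneForm E M) (g : C^∞⟮𝓘(ℝ, E), M; ℝ⟯) {Y : ∀ x : M, T E x}
    (hY : IsSmoothVF Y) (x : M) :
    lieDeriv (fun z => Ω.sharp z (α.1 z)) (OneForm.d (E := E) g).1 Y x
      = dAt (E := E) (fun z => Ω.poisson z ((OneForm.d (E := E) g).1 z) (α.1 z)) x (Y x) := by
  have h := dAt_mlieBracket g.contMDiff (Ω.mdifferentiableAt_sharp α x)
    (hY.mdifferentiableAt (by simp) (x := x))
  simp only [poisson_eq]
  rw [lieDeriv]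
  change _ - dAt (E := E) g x _ = _
  rw [h]
  exact sub_sub_cancel _ _

/-- The bracket of exact forms: `[df, dg] = -d{f, g}`. -/
theorem formBracket_d (f g : C^∞⟮𝓘(ℝ, E), M; ℝ⟯) {Y : ∀ x : M, T E x} (hY : IsSmoothVF Y) (x : M) :
    Ω.formBracket (OneForm.d (E := E) f).1 (OneForm.d (E := E) g).1 Y x
      = - dAt (Ω.bracket f g) x (Y x) := by
  have h1 : dAt (E := E) (fun z => Ω.poisson z ((OneForm.d (E := E) g).1 z)
      ((OneForm.d (E := E) f).1 z)) x = - dAt (Ω.bracket f g) x := by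
    rw [← dAt_neg]
    refine congrArg (fun F => dAt F x) (funext fun z => ?_)
    rw [bracket, poisson_eq, poisson_eq, apply_sharp_swap]
    rfl
  rw [formBracket, lieDeriv_d Ω _ _ hY, lieDeriv_d Ω _ _ hY, h1]
  exact sub_add_cancel _ _

end SymplecticForm

/-! ### Symmetry of the Hessian and vanishing of its trace. -/

namespace ContravariantDerivative

variable {Ω : SymplecticForm E M} {D : ContravariantDerivative Ω} [T2Space M]

theorem IsTorsionFree.d (hT : D.IsTorsionFree) (f g : C^∞⟮𝓘(ℝ, E), M; ℝ⟯) (x : M) :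
    D.toLin (OneForm.d f) x (dAt g x) - D.toLin (OneForm.d g) x (dAt f x)
      = dAt (Ω.bracket f g) x := by
  ext v
  obtain ⟨Y, hY, rfl⟩ := exists_isSmoothVF_eq v
  have h := hT (OneForm.d f) (OneForm.d g) Y hY x
  rw [Ω.formBracket_d f g hY, LinearMap.sub_apply] at h
  rw [LinearMap.sub_apply, ← neg_eq_iff_eq_neg.2 h, neg_sub]
  rfl

/-- The Hessian of a smooth function with respect to a torsion free Poisson connection is
symmetric. -/
theorem hessian_symm (hD : D.IsPoisson) (hT : D.IsTorsionFree) (f : C^∞⟮𝓘(ℝ, E), M; ℝ⟯) (x : M)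
    (α β : CoT E x) :
    D.toLin (OneForm.d f) x α (Ω.sharp x β) = D.toLin (OneForm.d f) x β (Ω.sharp x α) := by
  obtain ⟨g, rfl⟩ := exists_dAt_eq α
  obtain ⟨h, rfl⟩ := exists_dAt_eq β
  have hp (a b c : C^∞⟮𝓘(ℝ, E), M; ℝ⟯) : dAt (Ω.bracket a b) x (Ω.sharp x (dAt c x))
      = D.toLin (OneForm.d a) x (dAt c x) (Ω.sharp x (dAt b x))
        - D.toLin (OneForm.d b) x (dAt c x) (Ω.sharp x (dAt a x)) := by
    have h1 := hD (OneForm.d c) (OneForm.d a) (OneForm.d b) x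
    rw [Ω.poisson_eq, Ω.poisson_eq, Ω.apply_sharp_swap x ((OneForm.d (E := E) a).1 x)] at h1
    exact h1
  have ht (a b c : C^∞⟮𝓘(ℝ, E), M; ℝ⟯) : dAt (Ω.bracket a b) x (Ω.sharp x (dAt c x))
      = D.toLin (OneForm.d a) x (dAt b x) (Ω.sharp x (dAt c x))
        - D.toLin (OneForm.d b) x (dAt a x) (Ω.sharp x (dAt c x)) := by
    rw [← hT.d, LinearMap.sub_apply]
  -- Let A_a(b, c) be the skew part of the Hessian of a. Comparing `hp` with `ht` gives A_a(b, c) =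
  -- A_b(a, c). Being symmetric in one pair of slots and skew in another, A is zero.
  linarith [hp f g h, hp g h f, hp h f g, ht f g h, ht g h f, ht h f g]

/-- Writing eᵢ = ∑ⱼ ω(eᵢ, eⱼ) ♯θʲ turns the trace into a contraction of a symmetric form with an
antisymmetric one, so it equals its own negative. -/
theorem sum_toLin_d_apply (hD : D.IsPoisson) (hT : D.IsTorsionFree) (f : C^∞⟮𝓘(ℝ, E), M; ℝ⟯)
    {x : M} {N : ℕ} {e : Fin N → T E x} {θ : Fin N → CoT E x}
    (he : ∀ v, ∑ i, θ i v • e i = v) :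
    ∑ i, D.toLin (OneForm.d f) x (θ i) (e i) = 0 := by
  have h1 (i) : D.toLin (OneForm.d f) x (θ i) (e i)
      = ∑ j, Ω.flat x (e i) (e j) * D.toLin (OneForm.d f) x (θ i) (Ω.sharp x (θ j)) := by
    conv_lhs => rw [← Ω.sharp_flat x (e i), ← sum_apply_smul_dual he (Ω.flat x (e i))]
    simp [map_sum, map_smul]
  have h2 : ∑ i, D.toLin (OneForm.d f) x (θ i) (e i)
      = - ∑ i, D.toLin (OneForm.d f) x (θ i) (e i) := by
    simp only [h1]
    conv_lhs => rw [Finset.sum_comm]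
    simp only [← Finset.sum_neg_distrib]
    refine Finset.sum_congr rfl fun i _ => Finset.sum_congr rfl fun j _ => ?_
    rw [Ω.flat_swap, hessian_symm hD hT f x (θ j), neg_mul]
  linarith

end ContravariantDerivative

end Symp

namespace Symp

variable {E : Type*} [NormedAddCommGroup E] [NormedSpace ℝ E] [FiniteDimensional ℝ E]
  {M : Type*} [TopologicalSpace M] [T2Space M] [ChartedSpace E M] [IsManifold 𝓘(ℝ, E) ∞ M]

/-! ### Local representations of forms. -/

/-- The sum runs over all multi-indices rather than increasing ones, whence the factor 1/k!: each
permutation in the determinant contributes one copy of η. -/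
theorem apply_eq_sum_wedge {V : Type*} [AddCommGroup V] [Module ℝ V] {N k : ℕ} {e : Fin N → V}
    {θ : Fin N → Module.Dual ℝ V} (he : ∀ v, ∑ i, θ i v • e i = v) (η : V [⋀^Fin k]→ₗ[ℝ] ℝ) :
    η = ∑ I : Fin k → Fin N, ((k.factorial : ℝ)⁻¹ * η (fun a => e (I a))) •
      wedge (fun a => θ (I a)) := by
  have hexp (v : Fin k → V) : η v = ∑ I : Fin k → Fin N, (∏ a, θ (I a) (v a)) *
      η (fun a => e (I a)) := by
    conv_lhs => rw [show v = fun a => ∑ i, θ i (v a) • e i from funext fun a => (he (v a)).symm]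
    refine (η.toMultilinearMap.map_sum _).trans ?_
    exact Finset.sum_congr rfl fun I _ => η.toMultilinearMap.map_smul_univ _ _
  ext v
  rw [alternating_sum_apply]
  have h1 : ∑ I : Fin k → Fin N, η (fun a => e (I a)) * wedge (fun a => θ (I a)) v
      = (k.factorial : ℝ) * η v := by
    simp only [wedge_apply, Matrix.det_apply', Matrix.of_apply, Finset.mul_sum]
    rw [Finset.sum_comm]
    have h2 (σ : Equiv.Perm (Fin k)) : ∑ I : Fin k → Fin N, η (fun a => e (I a)) *
        (((Equiv.Perm.sign σ : ℤ) : ℝ) * ∏ a, θ (I a) (v (σ a))) = η v := by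
      have h3 : η (v ∘ σ) = ((Equiv.Perm.sign σ : ℤ) : ℝ) * η v := by
        rw [η.map_perm, Units.smul_def, zsmul_eq_mul]
      have h4 : ((Equiv.Perm.sign σ : ℤ) : ℝ) * ((Equiv.Perm.sign σ : ℤ) : ℝ) = 1 := by
        rw [← Int.cast_mul, ← Units.val_mul, Int.units_mul_self]; simp
      have h5 := hexp (v ∘ σ)
      rw [h3] at h5
      rw [← one_mul (η v), ← h4, mul_assoc, h5, Finset.mul_sum]
      refine Finset.sum_congr rfl fun I _ => ?_
      simp only [Function.comp_apply]
      ring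
    simp only [h2, Finset.sum_const, Finset.card_univ, Fintype.card_perm, Fintype.card_fin,
      nsmul_eq_mul]
  have h6 : (k.factorial : ℝ) ≠ 0 := by exact_mod_cast k.factorial_ne_zero
  calc η v = (k.factorial : ℝ)⁻¹ * ((k.factorial : ℝ) * η v) := by field_simp
    _ = _ := by
      rw [← h1, Finset.mul_sum]
      refine Finset.sum_congr rfl fun I _ => ?_
      rw [AlternatingMap.smul_apply, smul_eq_mul, mul_assoc]

/-- Near every point a form is a sum of forms `φ₀ dφ₁ ∧ ⋯ ∧ dφ_k`. -/
theorem exists_local_representation {k : ℕ} (η : Form E M k) (x : M) :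
    ∃ (n : ℕ) (φ₀ : Fin n → C^∞⟮𝓘(ℝ, E), M; ℝ⟯) (φ : Fin n → Fin k → C^∞⟮𝓘(ℝ, E), M; ℝ⟯),
      ∀ᶠ z in 𝓝 x, η.1 z = ∑ s, φ₀ s z • wedge (fun j => dAt (φ s j) z) := by
  obtain ⟨u, W, hW, hu⟩ := exists_coordinates (E := E) x
  let I := Fin k → Fin (Module.finrank ℝ E)
  let c (i : I) : C^∞⟮𝓘(ℝ, E), M; ℝ⟯ := ⟨fun z => (k.factorial : ℝ)⁻¹ * η.1 z (fun a => W (i a) z),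
    contMDiff_const.mul (η.2 _ fun a => hW (i a))⟩
  let ε := (Fintype.equivFin I).symm
  refine ⟨Fintype.card I, fun s => c (ε s), fun s j => u (ε s j), ?_⟩
  filter_upwards [hu] with z hz
  rw [ε.sum_comp (fun i : I => c i z • wedge (fun j => dAt (E := E) (u (i j)) z))]
  exact apply_eq_sum_wedge hz.2 (η.1 z)

/-! ### The induced connection on decomposable forms and its contraction. -/

namespace ContravariantDerivative

variable {Ω : SymplecticForm E M} {D : ContravariantDerivative Ω}

variable (D) in
/-- The derivative `D_h (∑ₛ φ₀ˢ dφ₁ˢ ∧ ⋯ ∧ dφ_kˢ)` of a sum of decomposable forms. -/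
noncomputable def wedgeDeriv {k n : ℕ} (φ₀ : Fin n → C^∞⟮𝓘(ℝ, E), M; ℝ⟯)
    (φ : Fin n → Fin k → C^∞⟮𝓘(ℝ, E), M; ℝ⟯) (x : M) (h : CoT E x) : T E x [⋀^Fin k]→ₗ[ℝ] ℝ :=
  ∑ s, (dAt (φ₀ s) x (Ω.sharp x h) • wedge (fun j => dAt (φ s j) x)
    + φ₀ s x • ∑ j, wedge (Function.update (fun j => dAt (φ s j) x) j
        (D.toLin (OneForm.d (φ s j)) x h)))

/-- The Poisson condition with its direction a single covector: any covector at `x` is the value of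
a global exact form. -/
theorem IsPoisson.dAt_apply_sharp (hD : D.IsPoisson) (β γ : OneForm E M) (x : M) (h : CoT E x) :
    dAt (E := E) (fun z => β.1 z (Ω.sharp z (γ.1 z))) x (Ω.sharp x h)
      = D.toLin β x h (Ω.sharp x (γ.1 x)) + β.1 x (Ω.sharp x (D.toLin γ x h)) := by
  obtain ⟨f, rfl⟩ := exists_dAt_eq h
  have h1 := hD (OneForm.d f) β γ x
  simp only [Ω.poisson_eq] at h1
  exact h1

/-- The Leibniz rule for exterior products, paired with `1`-forms. -/
theorem IsPoisson.dAt_wedge (hD : D.IsPoisson) {k : ℕ} (β α : Fin k → OneForm E M) (x : M)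
    (h : CoT E x) :
    dAt (E := E) (fun z => wedge (fun j => (β j).1 z) (fun i => Ω.sharp z ((α i).1 z))) x
        (Ω.sharp x h)
      = ∑ j, wedge (Function.update (fun j => (β j).1 x) j (D.toLin (β j) x h))
          (fun i => Ω.sharp x ((α i).1 x))
        + ∑ i, wedge (fun j => (β j).1 x)
          (fun a => Ω.sharp x (Function.update (fun j => (α j).1 x) i (D.toLin (α i) x h) a)) := by
  simp only [wedge_apply]
  rw [dAt_det (P := fun i j z => (β j).1 z (Ω.sharp z ((α i).1 z)))
    fun i j => Ω.mdifferentiableAt_apply_sharp (β j) (α i) x]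
  let P : Matrix (Fin k) (Fin k) ℝ := Matrix.of fun i j => (β j).1 x (Ω.sharp x ((α i).1 x))
  let R : Matrix (Fin k) (Fin k) ℝ :=
    Matrix.of fun i j => (β j).1 x (Ω.sharp x (D.toLin (α i) x h))
  have h1 (j : Fin k) : (P.updateCol j fun i => dAt (E := E)
      (fun z => (β j).1 z (Ω.sharp z ((α i).1 z))) x (Ω.sharp x h)).det
      = (P.updateCol j fun i => D.toLin (β j) x h (Ω.sharp x ((α i).1 x))).det
        + (P.updateCol j fun i => R i j).det := by
    rw [← Matrix.det_updateCol_add]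
    congr 2
    funext i
    exact hD.dAt_apply_sharp (β j) (α i) x h
  refine (Finset.sum_congr rfl fun j _ => h1 j).trans ?_
  -- The terms where D hits an argument αᵢ appear by columns but belong to rows.
  rw [Finset.sum_add_distrib, sum_det_updateCol_eq_sum_det_updateRow]
  congr 1
  · refine Finset.sum_congr rfl fun j _ => congrArg Matrix.det ?_
    ext a b
    by_cases hb : b = j
    · subst hb; simp
    · simp [hb, P]
  · refine Finset.sum_congr rfl fun i _ => congrArg Matrix.det ?_
    ext a b
    by_cases ha : a = i
    · subst ha; simp [R]
    · simp [ha, P]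

theorem mdifferentiableAt_wedge_sharp (Ω : SymplecticForm E M) {k : ℕ} (β α : Fin k → OneForm E M)
    (x : M) : MDifferentiableAt 𝓘(ℝ, E) 𝓘(ℝ, ℝ)
      (fun z => wedge (fun j => (β j).1 z) (fun i => Ω.sharp z ((α i).1 z))) x :=
  mdifferentiableAt_det fun i j => Ω.mdifferentiableAt_apply_sharp (β j) (α i) x

/-- This is the defining property of `multi`, verified for the Leibniz candidate: in `dAt_wedge` the
terms differentiating the arguments are exactly the ones subtracted. -/
theorem IsPoisson.sharpK_wedgeDeriv_apply (hD : D.IsPoisson) {k n : ℕ} (η : Form E M k) {x : M}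
    {φ₀ : Fin n → C^∞⟮𝓘(ℝ, E), M; ℝ⟯} {φ : Fin n → Fin k → C^∞⟮𝓘(ℝ, E), M; ℝ⟯}
    (hη : ∀ᶠ z in 𝓝 x, η.1 z = ∑ s, φ₀ s z • wedge (fun j => dAt (φ s j) z)) (h : CoT E x)
    (α : Fin k → OneForm E M) :
    Ω.sharpK x (D.wedgeDeriv φ₀ φ x h) (fun i => (α i).1 x)
      = dAt (E := E) (fun z => Ω.sharpK z (η.1 z) (fun i => (α i).1 z)) x (Ω.sharp x h)
        - ∑ i, Ω.sharpK x (η.1 x)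
            (Function.update (fun j => (α j).1 x) i (D.toLin (α i) x h)) := by
  let w (s : Fin n) (z : M) : ℝ :=
    wedge (fun j => (OneForm.d (E := E) (φ s j)).1 z) (fun i => Ω.sharp z ((α i).1 z))
  have hw (s) : MDifferentiableAt 𝓘(ℝ, E) 𝓘(ℝ, ℝ) (w s) x :=
    mdifferentiableAt_wedge_sharp Ω _ _ x
  have h1 : (fun z => Ω.sharpK z (η.1 z) (fun i => (α i).1 z)) =ᶠ[𝓝 x]
      fun z => (-1 : ℝ) ^ k * ∑ s, φ₀ s z * w s z := by
    filter_upwards [hη] with z hz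
    rw [Ω.sharpK_apply, hz, alternating_sum_apply]
    rfl
  have h2 (s) : MDifferentiableAt 𝓘(ℝ, E) 𝓘(ℝ, ℝ) (fun z => φ₀ s z * w s z) x :=
    (φ₀ s).mdifferentiableAt.mul (hw s)
  rw [dAt_congr h1, dAt_const_mul _ (mdifferentiableAt_finset_sum _ fun s _ => h2 s),
    dAt_sum _ fun s _ => h2 s, LinearMap.smul_apply, LinearMap.sum_apply]
  simp only [Ω.sharpK_apply, smul_eq_mul]
  rw [← Finset.mul_sum, ← mul_sub, hη.self_of_nhds, wedgeDeriv]
  simp only [alternating_sum_apply]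
  rw [Finset.sum_comm, ← Finset.sum_sub_distrib]
  congr 1
  refine Finset.sum_congr rfl fun s _ => ?_
  rw [dAt_mul (φ₀ s).mdifferentiableAt (hw s), LinearMap.add_apply, LinearMap.smul_apply,
    LinearMap.smul_apply, hD.dAt_wedge, AlternatingMap.add_apply, AlternatingMap.smul_apply,
    AlternatingMap.smul_apply, alternating_sum_apply]
  simp only [AlternatingMap.smul_apply, smul_eq_mul, ← Finset.mul_sum]
  change dAt (E := E) (φ₀ s) x _ * w s x + φ₀ s x * ∑ j, _ = φ₀ s x * (∑ j, _ + ∑ i, _)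
    + w s x * _ - φ₀ s x * ∑ i, _
  simp only [OneForm.d]
  ring

/-- Existence comes from the Leibniz candidate. Uniqueness holds because exact forms realize all
covectors at `x`, so the chosen multivector is determined by its defining property. -/
theorem IsPoisson.multi_sharpK (hD : D.IsPoisson) {k n : ℕ} (η : Form E M k) {x : M}
    {φ₀ : Fin n → C^∞⟮𝓘(ℝ, E), M; ℝ⟯} {φ : Fin n → Fin k → C^∞⟮𝓘(ℝ, E), M; ℝ⟯}
    (hη : ∀ᶠ z in 𝓝 x, η.1 z = ∑ s, φ₀ s z • wedge (fun j => dAt (φ s j) z)) (h : CoT E x) :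
    D.multi (fun z => Ω.sharpK z (η.1 z)) x h = Ω.sharpK x (D.wedgeDeriv φ₀ φ x h) := by
  have hspec := hD.sharpK_wedgeDeriv_apply η hη h
  have hex : ∃ B : CoT E x [⋀^Fin k]→ₗ[ℝ] ℝ, ∀ α : Fin k → OneForm E M,
      B (fun i => (α i).1 x) =
        dAt (E := E) (fun z => Ω.sharpK z (η.1 z) (fun i => (α i).1 z)) x (Ω.sharp x h)
          - ∑ i, Ω.sharpK x (η.1 x)
            (Function.update (fun j => (α j).1 x) i (D.toLin (α i) x h)) := ⟨_, hspec⟩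
  rw [multi, dif_pos hex]
  ext α
  choose f hf using fun i => exists_dAt_eq (α i)
  have h1 := (hex.choose_spec fun i => OneForm.d (f i)).trans (hspec fun i => OneForm.d (f i)).symm
  have h2 : (fun i => (OneForm.d (E := E) (f i)).1 x) = α := funext hf
  rwa [h2] at h1

theorem IsPoisson.nabla_sharp (hD : D.IsPoisson) {k n : ℕ} (η : Form E M k) {x : M}
    {φ₀ : Fin n → C^∞⟮𝓘(ℝ, E), M; ℝ⟯} {φ : Fin n → Fin k → C^∞⟮𝓘(ℝ, E), M; ℝ⟯}
    (hη : ∀ᶠ z in 𝓝 x, η.1 z = ∑ s, φ₀ s z • wedge (fun j => dAt (φ s j) z)) (h : CoT E x) :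
    D.nabla η x (Ω.sharp x h) = D.wedgeDeriv φ₀ φ x h := by
  rw [nabla, Ω.flat_sharp, hD.multi_sharpK η hη, Ω.flatK_sharpK]

theorem sum_curryLeft_wedge_update_eq_deltaOnSnd (hD : D.IsPoisson) (hT : D.IsTorsionFree)
    {k N : ℕ} (φ₀ : C^∞⟮𝓘(ℝ, E), M; ℝ⟯) (φ : Fin (k + 1) → C^∞⟮𝓘(ℝ, E), M; ℝ⟯) {x : M}
    {e : Fin N → T E x} {θ : Fin N → CoT E x} (he : ∀ v, ∑ i, θ i v • e i = v) :
    φ₀ x • ∑ i, ∑ j, (wedge (Function.update (fun j => dAt (φ j) x) j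
        (D.toLin (OneForm.d (φ j)) x (θ i)))).curryLeft (e i)
      = Ω.deltaOnSnd φ₀ (fun j => φ j) x := by
  rw [sum_curryLeft_wedge_update he _ (fun j => D.toLin (OneForm.d (φ j)) x)
    fun j => sum_toLin_d_apply hD hT (φ j) he]
  cases k with
  | zero => simp [SymplecticForm.deltaOnSnd]
  | succ k =>
    rw [sum_sum_wedge_update_succAbove _ _ (fun i j => dAt (Ω.bracket (φ i) (φ j)) x)
      fun i j => hT.d (φ i) (φ j) x]
    simp only [SymplecticForm.deltaOnSnd, Finset.smul_sum, smul_ite, smul_zero, smul_smul]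
    simp only [mul_comm (φ₀ x)]

/-- The heart of the proof: the left side involves no representation and the right side no frame, so
each is independent of both choices. -/
theorem sum_curryLeft_nabla (hD : D.IsPoisson) (hT : D.IsTorsionFree)
    {k n N : ℕ} (η : Form E M (k + 1)) {x : M}
    {φ₀ : Fin n → C^∞⟮𝓘(ℝ, E), M; ℝ⟯} {φ : Fin n → Fin (k + 1) → C^∞⟮𝓘(ℝ, E), M; ℝ⟯}
    (hη : ∀ᶠ z in 𝓝 x, η.1 z = ∑ s, φ₀ s z • wedge (fun j => dAt (φ s j) z))
    {e : Fin N → T E x} {θ : Fin N → CoT E x} (he : ∀ v, ∑ i, θ i v • e i = v) :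
    ∑ i, (D.nabla η x (Ω.sharp x (θ i))).curryLeft (e i)
      = ∑ s, Ω.deltaOn (φ₀ s) (fun j => φ s j) x := by
  let ι (v : T E x) : (T E x [⋀^Fin (k + 1)]→ₗ[ℝ] ℝ) →ₗ[ℝ] (T E x [⋀^Fin k]→ₗ[ℝ] ℝ) :=
    { toFun := fun η => η.curryLeft v
      map_add' := fun _ _ => rfl
      map_smul' := fun _ _ => rfl }
  have h1 (i) : (D.nabla η x (Ω.sharp x (θ i))).curryLeft (e i)
      = ∑ s, (dAt (φ₀ s) x (Ω.sharp x (θ i)) • (wedge (fun j => dAt (φ s j) x)).curryLeft (e i)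
        + φ₀ s x • ∑ j, (wedge (Function.update (fun j => dAt (φ s j) x) j
          (D.toLin (OneForm.d (φ s j)) x (θ i)))).curryLeft (e i)) := by
    rw [hD.nabla_sharp η hη]
    change ι (e i) _ = _
    rw [wedgeDeriv, map_sum]
    refine Finset.sum_congr rfl fun s _ => ?_
    rw [map_add, map_smul, map_smul, map_sum]
    rfl
  simp only [h1]
  rw [Finset.sum_comm]
  refine Finset.sum_congr rfl fun s _ => ?_
  rw [Finset.sum_add_distrib, ← Finset.smul_sum,
    sum_curryLeft_wedge_update_eq_deltaOnSnd hD hT (φ₀ s) (φ s) he, SymplecticForm.deltaOn]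
  congr 1
  simp only [curryLeft_wedge, Finset.smul_sum, smul_smul]
  rw [Finset.sum_comm]
  refine Finset.sum_congr rfl fun j _ => ?_
  rw [← Finset.sum_smul, SymplecticForm.bracket, Ω.poisson_eq]
  congr 1
  -- Expanding dφⱼ in the coframe gives {φ₀, φⱼ} = ∑ᵢ dφⱼ(eᵢ) dφ₀(♯θⁱ).
  conv_rhs => rw [← sum_apply_smul_dual he (dAt (φ s j) x), map_sum, map_sum, Finset.mul_sum]
  refine Finset.sum_congr rfl fun i _ => ?_
  rw [map_smul, map_smul, smul_eq_mul]
  ring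

/-- `Ω.delta` is characterized by any local representation. -/
theorem delta_eq_sum_deltaOn (hD : D.IsPoisson) (hT : D.IsTorsionFree) {k n : ℕ}
    (η : Form E M (k + 1)) {x : M}
    {φ₀ : Fin n → C^∞⟮𝓘(ℝ, E), M; ℝ⟯} {φ : Fin n → Fin (k + 1) → C^∞⟮𝓘(ℝ, E), M; ℝ⟯}
    (hη : ∀ᶠ z in 𝓝 x, η.1 z = ∑ s, φ₀ s z • wedge (fun j => dAt (φ s j) z)) :
    Ω.delta η x = ∑ s, Ω.deltaOn (φ₀ s) (fun j => φ s j) x := by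
  obtain ⟨u, W, hW, hu⟩ := exists_coordinates (E := E) x
  have hex : ∃ B : T E x [⋀^Fin k]→ₗ[ℝ] ℝ,
      ∀ (n : ℕ) (φ₀ : Fin n → C^∞⟮𝓘(ℝ, E), M; ℝ⟯)
        (φ : Fin n → Fin (k + 1) → C^∞⟮𝓘(ℝ, E), M; ℝ⟯),
        (∀ᶠ z in 𝓝 x, η.1 z = ∑ s, φ₀ s z • wedge (fun j => dAt (φ s j) z)) →
        B = ∑ s, Ω.deltaOn (φ₀ s) (fun j => φ s j) x :=
    -- The witness is the contraction of ∇η in the coordinate frame at `x`, which serves all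
    -- representations at once.
    ⟨_, fun n φ₀ φ hη => sum_curryLeft_nabla hD hT η hη hu.self_of_nhds.2⟩
  rw [SymplecticForm.delta, dif_pos hex]
  exact hex.choose_spec n φ₀ φ hη

end ContravariantDerivative

end Symp

/-! ### The theorem. -/

theorem mainTheorem6 {E : Type*} [NormedAddCommGroup E] [NormedSpace ℝ E] [FiniteDimensional ℝ E]
    {M : Type*} [TopologicalSpace M] [T2Space M] [ChartedSpace E M]
    [IsManifold 𝓘(ℝ, E) ∞ M]
    (m : ℕ) (hm : Module.finrank ℝ E = 2 * m)
    (Ω : Symp.SymplecticForm E M) (D : Symp.ContravariantDerivative Ω)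
    (hD : D.IsPoisson) (hT : D.IsTorsionFree) (k : ℕ) :
    (∀ (φ₀ : C^∞⟮𝓘(ℝ, E), M; ℝ⟯) (φ : Fin (k + 1) → C^∞⟮𝓘(ℝ, E), M; ℝ⟯)
        (η : Symp.Form E M (k + 1)),
        (∀ x, η.1 x = φ₀ x • Symp.wedge (fun j => Symp.dAt (φ j) x)) →
        ∀ x, Ω.delta η x = Ω.deltaOn φ₀ (fun j => φ j) x) ∧
    (∀ (U : Set M), IsOpen U →
      ∀ (e : Fin (2 * m) → ∀ x : M, TangentSpace 𝓘(ℝ, E) x)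
        (θ : Fin (2 * m) → ∀ x : M, Module.Dual ℝ (TangentSpace 𝓘(ℝ, E) x)),
        IsLocalFrameOn 𝓘(ℝ, E) E ∞ e U →
        (∀ x ∈ U, ∀ i j, θ i x (e j x) = if i = j then 1 else 0) →
        ∀ (η : Symp.Form E M (k + 1)), ∀ x ∈ U,
          Ω.delta η x = ∑ i, (D.nabla η x (Ω.sharp x (θ i x))).curryLeft (e i x)) := by
  refine ⟨fun φ₀ φ η hη x => ?_, fun U _ e θ he hθ η x hx => ?_⟩
  · have h := Symp.ContravariantDerivative.delta_eq_sum_deltaOn hD hT η (x := x) (n := 1)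
      (φ₀ := fun _ => φ₀) (φ := fun _ => φ) (Filter.Eventually.of_forall fun z => by simp [hη z])
    simpa using h
  · obtain ⟨n, φ₀, φ, hφ⟩ := Symp.exists_local_representation η x
    -- Only the completeness relation of the frame at the single point `x` is needed.
    have hdual (v : TangentSpace 𝓘(ℝ, E) x) : ∑ i, θ i x v • e i x = v := by
      let b := he.toBasisAt hx
      have hb (i) : b i = e i x := he.toBasisAt_coe hx i
      have hv : ∀ i, θ i x v = b.repr v i := fun i => by
        conv_lhs => rw [← b.sum_repr v, map_sum]
        simp [hb, hθ x hx]
      simp only [hv, ← hb, b.sum_repr]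
    rw [Symp.ContravariantDerivative.delta_eq_sum_deltaOn hD hT η hφ,
      Symp.ContravariantDerivative.sum_curryLeft_nabla hD hT η hφ hdual]
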